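/- **Setting.** Let $\mathcal X\subset\mathbb R^{d_x}$ and $\mathcal A\subset\mathbb R^{d_a}$ be finite sets of states and actions, where one coordinate of every state equals $1$ (bias coordinate); a pair $\xi=(x,a)$ is regarded as a vector of $\mathbb R^{d}$, $d=d_x+d_a$. Consider a Markov decision process on them with transition probabilities $p(x'\mid x,a)$, an initial law $\rho_0$ on $\mathcal X\times\mathcal A$ with state marginal $\rho_0(x)=\sum_a\rho_0(x,a)$, rewards $r(x,a)\in[-1,1]$ and discount factor $\gamma\in(0,1)$. A policy is a function $f\ge 0$ with $\sum_a f(x,a)=1$ for every $x$; it induces the chain on $\mathcal X\times\mathcal A$ with transition matrix $p(x'\mid x,a)f(x',a')$ and the auxiliary chain with transition matrix $[\gamma p(x'\mid x,a)+(1-\gamma)\rho_0(x')]f(x',a')$. Assume that both chains are irreducible and aperiodic whenever $f>0$; let $\pi^f$ be the stationary distribution of the first one. Write $V^f(\xi)=\sum_{k\ge0}\gamma^k\,\mathbb E[r(\xi_k)\mid \xi_0=\xi]$ for the action-value function, $V^f(x)=\sum_a f(x,a)V^f(x,a)$, $J(f)=\sum_x\rho_0(x)V^f(x)$, and $\sigma^f_{\rho_0}(x,a)=\sum_{k\ge0}\gamma^k\,\mathbb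 P(x_k=x,a_k=a)$ for the visiting measure of the chain with $x_0\sim\rho_0$ and $a_k\sim f(x_k,\cdot)$ (for what follows it may also be normalised to the probability measure $(1-\gamma)\sigma^f_{\rho_0}$). Let $\sigma:\mathbb R\to\mathbb R$ be a non-constant $C^2$ activation function with $|\sigma|,|\sigma'|,|\sigma''|\le1$ and $\sigma(x)/|x|^{a}\to0$ as $x\to\pm\infty$ for every $a>0$. Let $\nu_0(dc,dw)$ be a probability measure on $\mathbb R\times\mathbb R^d$, absolutely continuous with respect to Lebesgue measure, with $|c|\le 1$ almost surely; assume that $\sigma$ is real analytic or that the law of $w$ charges every non-empty open set. Put $$A_{\xi,\xi'}=\int\big[\sigma(w\cdot\xi')\sigma(w\cdot\xi)+c^2\sigma'(w\cdot\xi')\sigma'(w\cdot\xi)\,(\xi\cdot\xi')\big]\,\nu_0(dc,dw).$$ Let $\zeta_t=\frac1{1+t}$, $\eta_t=\frac{1}{1+\log^2(t+1)}$, $\alpha>0$, and $\mathsf{clip}(y)=\max(\min(y,h),\ell)$ with real numbers $\ell,h$ (for instance $\ell=0$, $h=2$). **Theorem.** Let $(P_t,Q_t)_{t\ge0}$, with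 values in $\mathbb R^{\mathcal X\times\mathcal A}\times\mathbb R^{\mathcal X\times\mathcal A}$ and with arbitrary initial value, solve for all $t\ge 0$ $$\frac{dQ_t}{dt}(\xi)=\alpha\sum_{\xi'}A_{\xi,\xi'}\Big(r(\xi')+\gamma\sum_{z,a''}Q_t(z,a'')g_t(z,a'')p(z\mid\xi')-Q_t(\xi')\Big)\pi^{g_t}(\xi'),$$ $$\frac{dP_t}{dt}(\xi)=\sum_{\xi'=(x',a')}\zeta_t\,\mathsf{clip}(Q_t(\xi'))\Big[A_{\xi,\xi'}-\sum_{a''}f_t(x',a'')A_{\xi,(x',a'')}\Big]\sigma^{g_t}_{\rho_0}(\xi'),$$ where $f_t(x,a)=\mathrm{Softmax}(P_t)(x,a)=e^{P_t(x,a)}/\sum_{a'}e^{P_t(x,a')}$ and $g_t=\frac{\eta_t}{\#\mathcal A}+(1-\eta_t)f_t$. Then, as $t\to\infty$, $$\max_{\xi}\big|Q_t(\xi)-V^{f_t}(\xi)\big|=O(\eta_t).$$ Moreover $P\mapsto J(\mathrm{Softmax}(P))$ is differentiable, and if the clipping window contains the values of the problem, i.e. $\ell\le V^f(\xi)\le h$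 for all policies $f$ and all $\xi$, then $$\nabla_P J(f_t)\to 0\qquad\text{as }t\to\infty,$$ where $\nabla_PJ(f_t)$ is the gradient of $P\mapsto J(\mathrm{Softmax}(P))$ at $P_t$. -/

import Mathlib

open scoped Topology

noncomputable section

namespace ActorCritic

/-- A finite Markov decision process: `p x a x'` is the probability of moving to `x'` from state `x`
under action `a`, `ρ₀` is the law of the initial state-action pair, `r` is the reward and `γ` the
discount factor. -/
structure MDP (X A : Type*) [Fintype X] [Fintype A] where
  p : X → A → X → ℝ
  p_nonneg : ∀ x a x', 0 ≤ p x a x'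
  p_sum : ∀ x a, ∑ x', p x a x' = 1
  ρ₀ : X × A → ℝ
  ρ₀_nonneg : ∀ ξ, 0 ≤ ρ₀ ξ
  ρ₀_sum : ∑ ξ, ρ₀ ξ = 1
  r : X × A → ℝ
  r_bound : ∀ ξ, |r ξ| ≤ 1
  γ : ℝ
  γ_pos : 0 < γ
  γ_lt_one : γ < 1

section Chains

/-- `f (x, a)` is the probability of selecting action `a` in state `x`. -/
structure IsPolicy {X A : Type*} [Fintype A] (f : X × A → ℝ) : Prop where
  nonneg : ∀ ξ, 0 ≤ f ξ
  sum_eq_one : ∀ x, ∑ a, f (x, a) = 1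

/-- Every state can be reached from every state. -/
def IsIrreducibleChain {S : Type*} [Fintype S] [DecidableEq S] (T : Matrix S S ℝ) : Prop :=
  ∀ i j, ∃ n : ℕ, 0 < (T ^ n) i j

/-- For every state, the greatest common divisor of its possible return times is `1`. -/
def IsAperiodicChain {S : Type*} [Fintype S] [DecidableEq S] (T : Matrix S S ℝ) : Prop :=
  ∀ i, ∀ d : ℕ, (∀ n : ℕ, 1 ≤ n → 0 < (T ^ n) i i → d ∣ n) → d = 1

/-- `π` is a stationary probability vector of the transition matrix `T`. -/
structure IsStationary {S : Type*} [Fintype S] (T : Matrix S S ℝ) (π : S → ℝ) : Prop where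
  nonneg : ∀ i, 0 ≤ π i
  sum_eq_one : ∑ i, π i = 1
  stationary : Matrix.vecMul π T = π

variable {X A : Type*} [Fintype X] [Fintype A]

/-- The law of the initial state. -/
def MDP.initState (M : MDP X A) (x : X) : ℝ := ∑ a, M.ρ₀ (x, a)

/-- Transition matrix of the state-action chain induced by the policy `f`. -/
def MDP.trans (M : MDP X A) (f : X × A → ℝ) : Matrix (X × A) (X × A) ℝ :=
  Matrix.of fun ξ ξ' => M.p ξ.1 ξ.2 ξ'.1 * f ξ'

/-- Transition matrix of the auxiliary chain, which restarts from the initial state law with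
probability `1 - γ` at every step. -/
def MDP.transAux (M : MDP X A) (f : X × A → ℝ) : Matrix (X × A) (X × A) ℝ :=
  Matrix.of fun ξ ξ' => (M.γ * M.p ξ.1 ξ.2 ξ'.1 + (1 - M.γ) * M.initState ξ'.1) * f ξ'

variable [DecidableEq X] [DecidableEq A]

/-- Both the chain and the auxiliary chain are ergodic under every policy that selects every action
with positive probability. -/
def MDP.IsErgodic (M : MDP X A) : Prop :=
  ∀ f : X × A → ℝ, IsPolicy f → (∀ ξ, 0 < f ξ) →
    (IsIrreducibleChain (M.trans f) ∧ IsAperiodicChain (M.trans f)) ∧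
    (IsIrreducibleChain (M.transAux f) ∧ IsAperiodicChain (M.transAux f))

/-- Action-value function `V^f(x, a) = ∑ₖ γᵏ 𝔼[r(ξₖ) | ξ₀ = (x, a)]`. -/
def MDP.actionValue (M : MDP X A) (f : X × A → ℝ) (ξ : X × A) : ℝ :=
  ∑' k : ℕ, M.γ ^ k * ((M.trans f) ^ k).mulVec M.r ξ

/-- State-value function: the first action is drawn from the policy. -/
def MDP.stateValue (M : MDP X A) (f : X × A → ℝ) (x : X) : ℝ :=
  ∑ a, f (x, a) * M.actionValue f (x, a)

/-- The objective `J(f) = ∑ₓ ρ₀(x) V^f(x)`. -/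
def MDP.objective (M : MDP X A) (f : X × A → ℝ) : ℝ :=
  ∑ x, M.initState x * M.stateValue f x

/-- The law of `ξₖ = (xₖ, aₖ)` when `x₀` has the initial state law and all actions are drawn
from `f`. -/
def MDP.law (M : MDP X A) (f : X × A → ℝ) (k : ℕ) : X × A → ℝ :=
  Matrix.vecMul (fun ξ => M.initState ξ.1 * f ξ) ((M.trans f) ^ k)

/-- State-action visiting measure `σ(x, a) = ∑ₖ γᵏ ℙ(xₖ = x, aₖ = a)`. -/
def MDP.visiting (M : MDP X A) (f : X × A → ℝ) (ξ : X × A) : ℝ :=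
  ∑' k : ℕ, M.γ ^ k * M.law f k ξ

end Chains

/-- Softmax policy with logits `P`. -/
def softmax {X A : Type*} [Fintype A] (P : X × A → ℝ) (ξ : X × A) : ℝ :=
  Real.exp (P ξ) / ∑ a, Real.exp (P (ξ.1, a))

/-- The vector of partial derivatives `∂ J(softmax P) / ∂ P(ξ)`. -/
def MDP.policyGradient {X A : Type*} [Fintype X] [Fintype A] [DecidableEq X] [DecidableEq A]
    (M : MDP X A) (P : X × A → ℝ) (ξ : X × A) : ℝ :=
  fderiv ℝ (fun P' : X × A → ℝ => M.objective (softmax P')) P (Pi.single ξ 1)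

/-- Actor learning rate. -/
def zeta (t : ℝ) : ℝ := 1 / (1 + t)

/-- Exploration rate. -/
def eta (t : ℝ) : ℝ := 1 / (1 + Real.log (t + 1) ^ 2)

/-- Exploration policy `g_t = η_t / #A + (1 - η_t) softmax P`. -/
def explore {X A : Type*} [Fintype A] (t : ℝ) (P : X × A → ℝ) (ξ : X × A) : ℝ :=
  eta t / (Fintype.card A : ℝ) + (1 - eta t) * softmax P ξ

/-- Truncation of a real number to the window `[lo, hi]`. -/
def clip (lo hi x : ℝ) : ℝ := max (min x hi) lo

/-- Assumptions on the activation function. -/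
structure IsActivation (act : ℝ → ℝ) : Prop where
  contDiff : ContDiff ℝ 2 act
  bound : ∀ x, |act x| ≤ 1
  deriv_bound : ∀ x, |deriv act x| ≤ 1
  deriv_two_bound : ∀ x, |deriv (deriv act) x| ≤ 1
  slow_atTop : ∀ a : ℝ, 0 < a → Filter.Tendsto (fun x => act x / |x| ^ a) Filter.atTop (𝓝 0)
  slow_atBot : ∀ a : ℝ, 0 < a → Filter.Tendsto (fun x => act x / |x| ^ a) Filter.atBot (𝓝 0)

/-- The space `ℝ^{dx + da}` of state-action vectors and of network weights. -/
abbrev Feat (dx da : ℕ) : Type := EuclideanSpace ℝ (Fin dx ⊕ Fin da)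

/-- The vector `(x, a) ∈ ℝ^{dx + da}` of a state-action pair, where `eX` and `eA` are the positions
of states and actions in `ℝ^{dx}` and `ℝ^{da}`. -/
def feature {X A : Type*} {dx da : ℕ} (eX : X → EuclideanSpace ℝ (Fin dx))
    (eA : A → EuclideanSpace ℝ (Fin da)) (ξ : X × A) : Feat dx da :=
  WithLp.toLp 2 (Sum.elim (fun i => eX ξ.1 i) (fun j => eA ξ.2 j))

/-- The limiting neural tangent kernel. -/
def kernel {X A : Type*} {dx da : ℕ} (eX : X → EuclideanSpace ℝ (Fin dx))
    (eA : A → EuclideanSpace ℝ (Fin da)) (act : ℝ → ℝ)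
    (ν₀ : MeasureTheory.Measure (ℝ × Feat dx da)) (ξ ξ' : X × A) : ℝ :=
  ∫ z : ℝ × Feat dx da,
    (act (inner ℝ z.2 (feature eX eA ξ')) * act (inner ℝ z.2 (feature eX eA ξ))
      + z.1 ^ 2 * deriv act (inner ℝ z.2 (feature eX eA ξ'))
        * deriv act (inner ℝ z.2 (feature eX eA ξ))
        * inner ℝ (feature eX eA ξ) (feature eX eA ξ')) ∂ν₀

/-- `(P, Q)` solves the limit ODE on `[0, ∞)` with kernel `K`, critic rate `α`, clipping window
`[lo, hi]`, and the visiting measure multiplied by the normalisation constant `κ`. -/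
structure IsLimitODESolution {X A : Type*} [Fintype X] [Fintype A] [DecidableEq X] [DecidableEq A]
    (M : MDP X A) (K : X × A → X × A → ℝ) (α κ lo hi : ℝ) (P Q : ℝ → X × A → ℝ) : Prop where
  critic : ∀ t : ℝ, 0 ≤ t → ∃ π : X × A → ℝ, IsStationary (M.trans (explore t (P t))) π ∧
    HasDerivWithinAt Q
      (fun ξ => α * ∑ ξ' : X × A, K ξ ξ' *
        (M.r ξ' + M.γ * (∑ z : X, ∑ a : A, Q t (z, a) * explore t (P t) (z, a) * M.p ξ'.1 ξ'.2 z)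
          - Q t ξ') * π ξ')
      (Set.Ici 0) t
  actor : ∀ t : ℝ, 0 ≤ t →
    HasDerivWithinAt P
      (fun ξ => ∑ ξ' : X × A, zeta t * clip lo hi (Q t ξ') *
        (K ξ ξ' - ∑ a : A, softmax (P t) (ξ'.1, a) * K ξ (ξ'.1, a)) *
        (κ * M.visiting (explore t (P t)) ξ'))
      (Set.Ici 0) t

end ActorCritic

end

/-!
The kernel `K` is positive definite: its quadratic form at `u` is the integral of the squared
parameter gradient of a network, so a null vector `u` produces a vanishing sum of ridge functions
`∑ u ξ * act ⟪w, ξ⟫`. The bias coordinate makes the ridge directions pairwise non-proportional,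
differencing along a vector orthogonal to one direction removes its term, and so, by induction on
the number of terms, each bounded function `u ξ * act` is constant, that is, `u ξ = 0`.

For the critic, let `φ = Q - V^g` with the exploration policy `g`. A stationary law of `g` is
bounded below by a power of `η`, since `g` dominates `η` times a fixed irreducible chain, and the
Bellman operator contracts in the `L²` norm of that law. Hence `φ ⬝ᵥ K⁻¹ φ` is damped at a rate
polynomial in `η`, while `V^g` moves at speed `O(1 / (1 + t))`. As `η` decays only
logarithmically, a multiple of `η²` is a barrier for this quantity, and `V^g - V^f = O(η)` by
Lipschitz continuity.

For the actor, the time change `u = log (1 + t)` turns the learning rate into `1` and `η` into the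
integrable function `1 / (1 + u²)`. The logits then follow a gradient ascent of `J`,
preconditioned by a multiple of `K`, up to an integrable error, so that `J` plus a multiple of
`arctan u` is a bounded increasing function whose derivative dominates the squared norm of the
gradient. The gradient is Lipschitz in `u` and therefore tends to zero.
-/

noncomputable section

namespace ActorCritic

section Kernel

open MeasureTheory

theorem eq_of_bounded_of_sub_eq_sub {G V : Type*} [AddCommGroup G] [NormedAddCommGroup V]
    [NormedSpace ℝ V] {g : G → V} (hg : ∃ C, ∀ x, ‖g x‖ ≤ C)
    (hsub : ∀ h x y, g (x + h) - g x = g (y + h) - g y) (x y : G) : g x = g y := by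
  obtain ⟨C, hC⟩ := hg
  have hmul : ∀ k : ℕ, g (x + k • (y - x)) = g x + k • (g y - g x) := by
    intro k
    induction k with
    | zero => simp
    | succ k ih =>
      have hstep := hsub (y - x) (x + k • (y - x)) x
      rw [add_sub_cancel, add_assoc, ← succ_nsmul] at hstep
      rw [succ_nsmul (g y - g x), ← add_assoc, ← ih, ← hstep, add_sub_cancel]
  have hbound : ∀ k : ℕ, k * ‖g y - g x‖ ≤ C + C := fun k => by
    calc k * ‖g y - g x‖ = ‖g (x + k • (y - x)) - g x‖ := by
          rw [hmul, add_sub_cancel_left, RCLike.norm_nsmul ℝ, nsmul_eq_mul]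
      _ ≤ C + C := (norm_sub_le _ _).trans (add_le_add (hC _) (hC _))
  by_contra hne
  obtain ⟨k, hk⟩ := exists_nat_gt ((C + C) / ‖g y - g x‖)
  rw [div_lt_iff₀ (norm_pos_iff.2 (sub_ne_zero.2 (Ne.symm hne)))] at hk
  exact (hbound k).not_gt hk

theorem ridge_eq_of_sum_eq_zero {ι 𝕜 E V : Type*} [Field 𝕜] [AddCommGroup E] [Module 𝕜 E]
    [NormedAddCommGroup V] [NormedSpace ℝ V] {ℓ : ι → Module.Dual 𝕜 E} (hℓ : ∀ i, ℓ i ≠ 0)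
    (hker : Pairwise fun i j => ¬ (ℓ j).ker ≤ (ℓ i).ker) (s : Finset ι) {g : ι → 𝕜 → V}
    (hg : ∀ i, ∃ C, ∀ x, ‖g i x‖ ≤ C) (hsum : ∀ w, ∑ i ∈ s, g i (ℓ i w) = 0) :
    ∀ i ∈ s, ∀ x y, g i x = g i y := by
  classical
  induction s using Finset.induction_on generalizing g with
  | empty => simp
  | insert j s hj ih =>
    have hs : ∀ i ∈ s, ∀ x y, g i x = g i y := by
      intro i hi
      refine eq_of_bounded_of_sub_eq_sub (hg i) fun h => ?_
      -- Differencing along `w ∈ ker (ℓ j)` removes the term of index `j`.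
      obtain ⟨w, hwj, hwi⟩ : ∃ w, ℓ j w = 0 ∧ ℓ i w = h := by
        obtain ⟨w, hwj, hwi⟩ := SetLike.not_le_iff_exists.1 (hker (ne_of_mem_of_not_mem hi hj))
        rw [LinearMap.mem_ker] at hwj hwi
        exact ⟨(h / ℓ i w) • w, by simp [hwj], by simp [hwi]⟩
      have hdiff := ih (g := fun k x => g k (x + ℓ k w) - g k x)
        (fun k => (hg k).elim fun D hD =>
          ⟨D + D, fun x => (norm_sub_le _ _).trans (add_le_add (hD _) (hD _))⟩)
        (fun z => by
          have hshift := hsum (z + w)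
          have hz := hsum z
          simp only [Finset.sum_insert hj, map_add, hwj, add_zero] at hshift hz
          rw [Finset.sum_sub_distrib, sub_eq_zero]
          exact add_left_cancel (hshift.trans hz.symm))
      simpa only [hwi] using hdiff i hi
    refine fun i hi => (Finset.mem_insert.1 hi).elim (fun hij x y => ?_) (hs i)
    subst hij
    obtain ⟨w, rfl⟩ := LinearMap.surjective (hℓ i) x
    obtain ⟨w', rfl⟩ := LinearMap.surjective (hℓ i) y
    have hw := (hsum w).trans (hsum w').symm
    rw [Finset.sum_insert hj, Finset.sum_insert hj,
      Finset.sum_congr rfl fun k hk => hs k hk (ℓ k w) (ℓ k w')] at hw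
    exact add_right_cancel hw

theorem ae_ne_zero_of_analyticOnNhd {E : Type*} [NormedAddCommGroup E] [NormedSpace ℝ E]
    [FiniteDimensional ℝ E] [MeasurableSpace E] [BorelSpace E] (μ : Measure E)
    [μ.IsAddHaarMeasure] {F : E → ℝ} (hF : AnalyticOnNhd ℝ F Set.univ) {w₀ : E} (hw₀ : F w₀ ≠ 0) :
    ∀ᵐ w ∂μ, F w ≠ 0 := by
  have hcont : Continuous F := continuousOn_univ.1 hF.continuousOn
  -- The identity theorem applies on each line through `w₀`; Fubini then gives a dilation of these
  -- lines for which almost every endpoint is good.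
  set p : E → ℝ → Prop := fun v t => F (w₀ + t • v) ≠ 0
  have hp : MeasurableSet {q : E × ℝ | p q.1 q.2} :=
    (isOpen_ne_fun (hcont.comp (by fun_prop)) continuous_const).measurableSet
  have hline : ∀ v, ∀ᵐ t : ℝ, p v t := by
    intro v
    have han : AnalyticOnNhd ℝ (fun t : ℝ => F (w₀ + t • v)) Set.univ := fun t _ =>
      (hF _ (Set.mem_univ _)).fun_comp (f := fun t : ℝ => w₀ + t • v) (by fun_prop)
    have := ae_restrict_le_codiscreteWithin (μ := (volume : Measure ℝ)) MeasurableSet.univ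
      (han.preimage_zero_mem_codiscrete (x := 0) (by simpa using hw₀))
    rwa [Measure.restrict_univ] at this
  have hdilation : ∀ᵐ t : ℝ, ∀ᵐ v ∂μ, p v t :=
    (Measure.ae_ae_comm hp).1 (Filter.Eventually.of_forall hline)
  obtain ⟨t, ht, ht0⟩ := (hdilation.and (Measure.ae_ne volume 0)).exists
  have hchart := ((Measure.quasiMeasurePreserving_smul μ (inv_ne_zero ht0)).comp
    (quasiMeasurePreserving_add_left μ (-w₀))).ae ht
  filter_upwards [hchart] with w hw
  simpa [p, smul_inv_smul₀ ht0] using hw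

/-- The shallow network with output weights `u` and activation `act`, whose ridge directions `v`
are the data, as a function of the parameter `w`. -/
def ridgeSum {ι E : Type*} [Fintype ι] [NormedAddCommGroup E] [InnerProductSpace ℝ E]
    (act : ℝ → ℝ) (v : ι → E) (u : ι → ℝ) (w : E) : ℝ :=
  ∑ i, u i * act (inner ℝ w (v i))

section RidgeSum

variable {ι E : Type*} [Fintype ι] [NormedAddCommGroup E] [InnerProductSpace ℝ E]
  {act : ℝ → ℝ} {v : ι → E} {u : ι → ℝ}

theorem continuous_ridgeSum (hact : Continuous act) : Continuous (ridgeSum act v u) := by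
  unfold ridgeSum
  fun_prop

theorem analyticOnNhd_ridgeSum (hact : AnalyticOnNhd ℝ act Set.univ) :
    AnalyticOnNhd ℝ (ridgeSum act v u) Set.univ := fun w _ =>
  Finset.analyticAt_fun_sum _ fun i _ => analyticAt_const.mul <|
    (hact _ (Set.mem_univ _)).fun_comp (f := fun w => inner ℝ w (v i))
      (((innerSL ℝ).flip (v i)).analyticAt w)

theorem eq_zero_of_ridgeSum_eq_zero (hbound : ∃ C, ∀ x, |act x| ≤ C)
    (hconst : ∃ x y, act x ≠ act y) (hv : ∀ i, v i ≠ 0)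
    (hker : Pairwise fun i j => ¬ ((innerₗ E).flip (v j)).ker ≤ ((innerₗ E).flip (v i)).ker)
    (h : ∀ w, ridgeSum act v u w = 0) : u = 0 := by
  obtain ⟨C, hC⟩ := hbound
  obtain ⟨x, y, hxy⟩ := hconst
  funext i
  have hℓ : ∀ i, (innerₗ E).flip (v i) ≠ 0 := fun i h0 =>
    hv i (inner_self_eq_zero.1 (LinearMap.congr_fun h0 (v i)))
  have hi := ridge_eq_of_sum_eq_zero hℓ hker Finset.univ (g := fun i x => u i * act x)
    (fun i => ⟨|u i| * C, fun x => by
      rw [Real.norm_eq_abs, abs_mul]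
      exact mul_le_mul_of_nonneg_left (hC x) (abs_nonneg _)⟩)
    h i (Finset.mem_univ i) x y
  exact by_contra fun hu => hxy (mul_left_cancel₀ hu hi)

end RidgeSum

variable {X A : Type*} {dx da : ℕ} {eX : X → EuclideanSpace ℝ (Fin dx)}
  {eA : A → EuclideanSpace ℝ (Fin da)}

theorem feature_injective (heX : Function.Injective eX) (heA : Function.Injective eA) :
    Function.Injective (feature eX eA) := by
  rintro ⟨x, a⟩ ⟨y, b⟩ h
  have hcoord : ∀ k, feature eX eA (x, a) k = feature eX eA (y, b) k := fun k => by rw [h]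
  refine Prod.ext (heX ?_) (heA ?_)
  · ext i
    exact hcoord (Sum.inl i)
  · ext i
    exact hcoord (Sum.inr i)

theorem not_ker_inner_le_ker_inner {ι : Type*} [Fintype ι]
    {v w : EuclideanSpace ℝ ι} {i : ι} (hv : v i = 1) (hw : w i = 1) (hne : v ≠ w) :
    ¬ ((innerₗ (EuclideanSpace ℝ ι)).flip w).ker ≤
      ((innerₗ (EuclideanSpace ℝ ι)).flip v).ker := by
  classical
  intro hle
  refine hne (PiLp.ext fun k => ?_)
  -- The vector `e_k - w_k e_i` is orthogonal to `w`.
  have hvk := @hle (EuclideanSpace.single k 1 - w k • EuclideanSpace.single i 1)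
    (by simp [inner_sub_right, real_inner_smul_right, EuclideanSpace.inner_single_right, hw])
  simpa [inner_sub_right, real_inner_smul_right, EuclideanSpace.inner_single_right, hv,
    sub_eq_zero] using hvk

variable {act : ℝ → ℝ} {ν₀ : Measure (ℝ × Feat dx da)}

theorem kernel_symm (ξ ξ' : X × A) : kernel eX eA act ν₀ ξ ξ' = kernel eX eA act ν₀ ξ' ξ := by
  unfold kernel
  congr 1
  funext z
  rw [real_inner_comm (feature eX eA ξ) (feature eX eA ξ')]
  ring

theorem integrable_kernel [IsFiniteMeasure ν₀] (hact : IsActivation act)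
    (hc : ∀ᵐ z ∂ν₀, |z.1| ≤ 1) (ξ ξ' : X × A) :
    Integrable (fun z : ℝ × Feat dx da =>
      act (inner ℝ z.2 (feature eX eA ξ')) * act (inner ℝ z.2 (feature eX eA ξ))
      + z.1 ^ 2 * deriv act (inner ℝ z.2 (feature eX eA ξ'))
        * deriv act (inner ℝ z.2 (feature eX eA ξ))
        * inner ℝ (feature eX eA ξ) (feature eX eA ξ')) ν₀ := by
  have hcont : Continuous act := hact.contDiff.continuous
  have hcont' : Continuous (deriv act) := hact.contDiff.continuous_deriv (by norm_num)
  refine Integrable.of_bound (C := 1 + |inner ℝ (feature eX eA ξ) (feature eX eA ξ')|)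
    (Continuous.aestronglyMeasurable (by fun_prop)) ?_
  filter_upwards [hc] with z hz
  rw [Real.norm_eq_abs]
  refine (abs_add_le _ _).trans (add_le_add ?_ ?_)
  · rw [abs_mul]
    exact mul_le_one₀ (hact.bound _) (abs_nonneg _) (hact.bound _)
  · rw [abs_mul, abs_mul, abs_mul, abs_pow]
    refine mul_le_of_le_one_left (abs_nonneg _) ?_
    exact mul_le_one₀ (mul_le_one₀ (pow_le_one₀ (abs_nonneg _) hz) (abs_nonneg _)
      (hact.deriv_bound _)) (abs_nonneg _) (hact.deriv_bound _)

section QuadraticForm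

variable [Fintype X] [Fintype A]

/-- The squared norm of the parameter gradient of the network, weighted by `u` over the data: the
integrand of the quadratic form of the neural tangent kernel. -/
def tangentSq (eX : X → EuclideanSpace ℝ (Fin dx)) (eA : A → EuclideanSpace ℝ (Fin da))
    (act : ℝ → ℝ) (u : X × A → ℝ) (z : ℝ × Feat dx da) : ℝ :=
  ridgeSum act (feature eX eA) u z.2 ^ 2 +
    z.1 ^ 2 * ‖∑ ξ, (u ξ * deriv act (inner ℝ z.2 (feature eX eA ξ))) • feature eX eA ξ‖ ^ 2

theorem tangentSq_nonneg (u : X × A → ℝ) : 0 ≤ tangentSq eX eA act u := fun _ =>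
  add_nonneg (sq_nonneg _) (mul_nonneg (sq_nonneg _) (sq_nonneg _))

theorem tangentSq_eq_sum (u : X × A → ℝ) :
    tangentSq eX eA act u = fun z => ∑ ξ, ∑ ξ',
      (act (inner ℝ z.2 (feature eX eA ξ')) * act (inner ℝ z.2 (feature eX eA ξ))
        + z.1 ^ 2 * deriv act (inner ℝ z.2 (feature eX eA ξ'))
          * deriv act (inner ℝ z.2 (feature eX eA ξ))
          * inner ℝ (feature eX eA ξ) (feature eX eA ξ')) * (u ξ * u ξ') := by
  funext z
  rw [tangentSq, ridgeSum, ← real_inner_self_eq_norm_sq, sum_inner, sq (∑ ξ, _),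
    Finset.sum_mul_sum, Finset.mul_sum, ← Finset.sum_add_distrib]
  refine Finset.sum_congr rfl fun ξ _ => ?_
  rw [inner_sum, Finset.mul_sum, ← Finset.sum_add_distrib]
  refine Finset.sum_congr rfl fun ξ' _ => ?_
  rw [real_inner_smul_left, real_inner_smul_right]
  ring

theorem integrable_tangentSq [IsFiniteMeasure ν₀] (hact : IsActivation act)
    (hc : ∀ᵐ z ∂ν₀, |z.1| ≤ 1) (u : X × A → ℝ) : Integrable (tangentSq eX eA act u) ν₀ := by
  rw [tangentSq_eq_sum]
  exact integrable_finsetSum _ fun ξ _ => integrable_finsetSum _ fun ξ' _ =>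
    (integrable_kernel hact hc ξ ξ').mul_const _

theorem dotProduct_kernel_mulVec [IsFiniteMeasure ν₀] (hact : IsActivation act)
    (hc : ∀ᵐ z ∂ν₀, |z.1| ≤ 1) (u : X × A → ℝ) :
    u ⬝ᵥ (Matrix.of (kernel eX eA act ν₀)).mulVec u = ∫ z, tangentSq eX eA act u z ∂ν₀ := by
  have hint := fun ξ ξ' : X × A =>
    (integrable_kernel (eX := eX) (eA := eA) hact hc ξ ξ').mul_const (u ξ * u ξ')
  rw [tangentSq_eq_sum]
  rw [integral_finsetSum _ fun ξ _ => integrable_finsetSum _ fun ξ' _ => hint ξ ξ']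
  refine Finset.sum_congr rfl fun ξ _ => ?_
  rw [integral_finsetSum _ fun ξ' _ => hint ξ ξ', Matrix.mulVec, dotProduct, Finset.mul_sum]
  refine Finset.sum_congr rfl fun ξ' _ => ?_
  rw [integral_mul_const, Matrix.of_apply, kernel]
  ring

theorem ridgeSum_ae_eq_zero [IsFiniteMeasure ν₀] (hact : IsActivation act)
    (hc : ∀ᵐ z ∂ν₀, |z.1| ≤ 1) {u : X × A → ℝ}
    (hu : u ⬝ᵥ (Matrix.of (kernel eX eA act ν₀)).mulVec u = 0) :
    ∀ᵐ w ∂ν₀.map Prod.snd, ridgeSum act (feature eX eA) u w = 0 := by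
  rw [dotProduct_kernel_mulVec hact hc,
    integral_eq_zero_iff_of_nonneg (tangentSq_nonneg u) (integrable_tangentSq hact hc u)] at hu
  refine (ae_map_iff measurable_snd.aemeasurable (isClosed_eq
    (continuous_ridgeSum hact.contDiff.continuous) continuous_const).measurableSet).2 ?_
  filter_upwards [hu] with z hz
  exact pow_eq_zero_iff two_ne_zero |>.1
    ((add_eq_zero_iff_of_nonneg (sq_nonneg _) (by positivity)).1 hz).1

end QuadraticForm

theorem eq_zero_of_ae_eq_zero {E : Type*} [NormedAddCommGroup E] [NormedSpace ℝ E]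
    [FiniteDimensional ℝ E] [MeasureSpace E] [BorelSpace E]
    [(volume : Measure E).IsAddHaarMeasure] {μ : Measure E} [NeZero μ] {F : E → ℝ}
    (hcont : Continuous F)
    (h : (μ ≪ volume ∧ AnalyticOnNhd ℝ F Set.univ) ∨ μ.IsOpenPosMeasure)
    (hae : ∀ᵐ w ∂μ, F w = 0) : F = 0 := by
  rcases h with ⟨hac, han⟩ | hopen
  · by_contra hne
    obtain ⟨w₀, hw₀⟩ := Function.ne_iff.1 hne
    obtain ⟨w, hw, hw'⟩ := (hae.and (hac.ae_le (ae_ne_zero_of_analyticOnNhd _ han hw₀))).exists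
    exact hw' hw
  · exact (hcont.ae_eq_iff_eq μ continuous_const).1 hae

theorem kernel_posDef [Finite X] [Finite A] [IsProbabilityMeasure ν₀]
    (heX : Function.Injective eX) (heA : Function.Injective eA)
    (hbias : ∃ i : Fin dx, ∀ x, eX x i = 1)
    (hact : IsActivation act) (hconst : ∃ x y, act x ≠ act y)
    (hac : ν₀ ≪ volume) (hc : ∀ᵐ z ∂ν₀, |z.1| ≤ 1)
    (hw : AnalyticOnNhd ℝ act Set.univ ∨
      ∀ U : Set (Feat dx da), IsOpen U → U.Nonempty → 0 < ν₀ (Prod.snd ⁻¹' U)) :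
    (Matrix.of (kernel eX eA act ν₀)).PosDef := by
  have := Fintype.ofFinite X
  have := Fintype.ofFinite A
  obtain ⟨i, hi⟩ := hbias
  have hone : ∀ ξ, feature eX eA ξ (Sum.inl i) = 1 := fun ξ => hi ξ.1
  have hne : ∀ ξ, feature eX eA ξ ≠ 0 := fun ξ h => by simpa [h] using hone ξ
  have hker : Pairwise fun ξ ξ' => ¬ ((innerₗ (Feat dx da)).flip (feature eX eA ξ')).ker ≤
      ((innerₗ (Feat dx da)).flip (feature eX eA ξ)).ker := fun ξ ξ' h =>
    not_ker_inner_le_ker_inner (hone ξ) (hone ξ') ((feature_injective heX heA).ne h)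
  have := Measure.isProbabilityMeasure_map (μ := ν₀) measurable_snd.aemeasurable
  have hlaw : (ν₀.map Prod.snd ≪ volume ∧ AnalyticOnNhd ℝ act Set.univ) ∨
      (ν₀.map Prod.snd).IsOpenPosMeasure := by
    refine hw.imp (fun han => ⟨?_, han⟩) fun hopen => ⟨fun U hU hne => ?_⟩
    · exact (hac.map measurable_snd).trans Measure.quasiMeasurePreserving_snd.absolutelyContinuous
    · rw [Measure.map_apply measurable_snd hU.measurableSet]
      exact (hopen U hU hne).ne'
  refine Matrix.PosDef.of_dotProduct_mulVec_pos ?_ fun u hu => ?_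
  · ext ξ ξ'
    exact kernel_symm ξ' ξ
  · refine lt_of_le_of_ne ?_ fun h0 => hu ?_
    · rw [star_trivial, dotProduct_kernel_mulVec hact hc]
      exact integral_nonneg (tangentSq_nonneg u)
    · have hzero := eq_zero_of_ae_eq_zero (continuous_ridgeSum hact.contDiff.continuous)
        (hlaw.imp_left fun h => ⟨h.1, analyticOnNhd_ridgeSum h.2⟩)
        (ridgeSum_ae_eq_zero hact hc h0.symm)
      exact eq_zero_of_ridgeSum_eq_zero ⟨1, hact.bound⟩ hconst hne hker (congrFun hzero)

end Kernel

section LinearAlgebra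

open Matrix
open scoped Matrix.Norms.Operator

variable {S : Type*} [Fintype S]

theorem norm_sq_le_dotProduct_self (v : S → ℝ) : ‖v‖ ^ 2 ≤ v ⬝ᵥ v := by
  refine (Real.le_sqrt (norm_nonneg v) (Finset.sum_nonneg fun i _ => mul_self_nonneg _)).1 ?_
  refine (pi_norm_le_iff_of_nonneg (Real.sqrt_nonneg _)).2 fun i => Real.abs_le_sqrt ?_
  rw [sq]
  exact Finset.single_le_sum (f := fun i => v i * v i) (fun i _ => mul_self_nonneg _)
    (Finset.mem_univ i)

theorem abs_dotProduct_le (v w : S → ℝ) : |v ⬝ᵥ w| ≤ Fintype.card S * (‖v‖ * ‖w‖) := by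
  calc |v ⬝ᵥ w| ≤ ∑ i, |v i * w i| := Finset.abs_sum_le_sum_abs _ _
    _ ≤ ∑ _i : S, ‖v‖ * ‖w‖ := Finset.sum_le_sum fun i _ => by
      rw [abs_mul]
      exact mul_le_mul (norm_le_pi_norm v i) (norm_le_pi_norm w i) (abs_nonneg _) (norm_nonneg _)
    _ = Fintype.card S * (‖v‖ * ‖w‖) := by simp

theorem exists_abs_dotProduct_mulVec_le (B : Matrix S S ℝ) :
    ∃ b, 0 < b ∧ ∀ v w : S → ℝ, |v ⬝ᵥ B *ᵥ w| ≤ b * (‖v‖ * ‖w‖) := by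
  refine ⟨Fintype.card S * ‖B‖ + 1, by positivity, fun v w => ?_⟩
  calc |v ⬝ᵥ B *ᵥ w| ≤ Fintype.card S * (‖v‖ * ‖B *ᵥ w‖) := abs_dotProduct_le _ _
    _ ≤ Fintype.card S * (‖v‖ * (‖B‖ * ‖w‖)) := by
      gcongr
      exact linfty_opNorm_mulVec B w
    _ ≤ (Fintype.card S * ‖B‖ + 1) * (‖v‖ * ‖w‖) := by
      nlinarith [mul_nonneg (norm_nonneg v) (norm_nonneg w)]

theorem exists_pos_mul_norm_sq_le_of_posDef {B : Matrix S S ℝ} (hB : B.PosDef) :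
    ∃ m, 0 < m ∧ ∀ v : S → ℝ, m * ‖v‖ ^ 2 ≤ v ⬝ᵥ B *ᵥ v := by
  rcases isEmpty_or_nonempty S with hS | hS
  · exact ⟨1, one_pos, fun v => by simp [Subsingleton.elim v 0]⟩
  obtain ⟨v₀, hv₀, hmin⟩ := (isCompact_sphere (0 : S → ℝ) 1).exists_isMinOn
    (NormedSpace.sphere_nonempty.2 zero_le_one)
    (f := fun v => v ⬝ᵥ B *ᵥ v) (by fun_prop)
  have hv₀_ne : v₀ ≠ 0 := ne_zero_of_mem_unit_sphere ⟨v₀, hv₀⟩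
  refine ⟨v₀ ⬝ᵥ B *ᵥ v₀, by simpa using hB.dotProduct_mulVec_pos hv₀_ne, fun v => ?_⟩
  rcases eq_or_ne v 0 with rfl | hv
  · simp
  have hnorm : ‖v‖ ≠ 0 := norm_ne_zero_iff.2 hv
  have hle := hmin (show ‖v‖⁻¹ • v ∈ Metric.sphere (0 : S → ℝ) 1 by simp [norm_smul, hnorm])
  simp only [Set.mem_ofPred_eq, mulVec_smul, dotProduct_smul, smul_dotProduct, smul_eq_mul] at hle
  calc v₀ ⬝ᵥ B *ᵥ v₀ * ‖v‖ ^ 2 ≤ ‖v‖⁻¹ * (‖v‖⁻¹ * v ⬝ᵥ B *ᵥ v) * ‖v‖ ^ 2 := by gcongr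
    _ = v ⬝ᵥ B *ᵥ v := by field_simp

theorem hasDerivAt_dotProduct_mulVec_self {B : Matrix S S ℝ} (hB : B.IsSymm) {φ : ℝ → S → ℝ}
    {φ' : S → ℝ} {t : ℝ} (h : HasDerivAt φ φ' t) :
    HasDerivAt (fun s => φ s ⬝ᵥ B *ᵥ φ s) (2 * φ t ⬝ᵥ B *ᵥ φ') t := by
  have hcoord := hasDerivAt_pi.1 h
  have hprod : HasDerivAt (fun s => φ s ⬝ᵥ B *ᵥ φ s) (φ' ⬝ᵥ B *ᵥ φ t + φ t ⬝ᵥ B *ᵥ φ') t := by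
    simp only [dotProduct, mulVec]
    rw [← Finset.sum_add_distrib]
    exact HasDerivAt.fun_sum fun i _ => (hcoord i).fun_mul
      (HasDerivAt.fun_sum fun j _ => (hcoord j).const_mul _)
  refine hprod.congr_deriv ?_
  rw [dotProduct_comm φ', dotProduct_mulVec (φ t), ← mulVec_transpose, hB.eq]
  ring

variable [DecidableEq S] {T : Matrix S S ℝ}

theorem linfty_opNorm_le_one_of_mem_rowStochastic (hT : T ∈ rowStochastic ℝ S) : ‖T‖ ≤ 1 := by
  rw [linfty_opNorm_def, ← NNReal.coe_one, NNReal.coe_le_coe]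
  refine Finset.sup_le fun i _ => ?_
  rw [← NNReal.coe_le_coe, NNReal.coe_sum, NNReal.coe_one, ← sum_row_of_mem_rowStochastic hT i]
  exact (Finset.sum_congr rfl fun j _ =>
    Real.norm_of_nonneg (nonneg_of_mem_rowStochastic hT)).le

end LinearAlgebra

section StationaryLaw

open Matrix

variable {S : Type*} [Fintype S] {T U : Matrix S S ℝ} {π : S → ℝ}

theorem IsStationary.exists_inv_card_le (hπ : IsStationary T π) :
    ∃ i, (Fintype.card S : ℝ)⁻¹ ≤ π i := by
  by_contra! hlt
  have hS : Nonempty S := by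
    by_contra h
    simpa [not_nonempty_iff.1 h] using hπ.sum_eq_one
  have hsum := Finset.sum_lt_sum_of_nonempty Finset.univ_nonempty fun i (_ : i ∈ Finset.univ) =>
    hlt i
  simp [hπ.sum_eq_one] at hsum

variable [DecidableEq S]

theorem IsStationary.vecMul_pow (hπ : IsStationary T π) (n : ℕ) : π ᵥ* T ^ n = π := by
  induction n with
  | zero => simp
  | succ n ih => rw [pow_succ, ← vecMul_vecMul, ih, hπ.stationary]

theorem IsStationary.mul_pow_apply_le (hπ : IsStationary T π) (hT : ∀ i j, 0 ≤ T i j) (n : ℕ)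
    (i j : S) : π i * (T ^ n) i j ≤ π j := by
  calc π i * (T ^ n) i j ≤ ∑ k, π k * (T ^ n) k j :=
        Finset.single_le_sum (f := fun k => π k * (T ^ n) k j)
          (fun k _ => mul_nonneg (hπ.nonneg k) (pow_apply_nonneg hT n k j)) (Finset.mem_univ i)
    _ = π j := congrFun (hπ.vecMul_pow n) j

theorem IsStationary.sum_mul_mulVec_le (hπ : IsStationary T π) (hT : T ∈ rowStochastic ℝ S)
    (φ : S → ℝ) : ∑ i, π i * (φ i * (T *ᵥ φ) i) ≤ ∑ i, π i * φ i ^ 2 := by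
  have hfst : ∑ i, ∑ j, π i * T i j * φ i ^ 2 = ∑ i, π i * φ i ^ 2 := by
    refine Finset.sum_congr rfl fun i _ => ?_
    rw [← Finset.sum_mul, ← Finset.mul_sum, sum_row_of_mem_rowStochastic hT, mul_one]
  have hsnd : ∑ i, ∑ j, π i * T i j * φ j ^ 2 = ∑ j, π j * φ j ^ 2 := by
    rw [Finset.sum_comm]
    refine Finset.sum_congr rfl fun j _ => ?_
    rw [← Finset.sum_mul]
    exact congrArg (· * φ j ^ 2) (congrFun hπ.stationary j)
  calc ∑ i, π i * (φ i * (T *ᵥ φ) i)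
      = ∑ i, ∑ j, π i * T i j * (φ i * φ j) := by
        refine Finset.sum_congr rfl fun i _ => ?_
        rw [mulVec, dotProduct, Finset.mul_sum, Finset.mul_sum]
        exact Finset.sum_congr rfl fun j _ => by ring
    _ ≤ ∑ i, ∑ j, (π i * T i j * φ i ^ 2 / 2 + π i * T i j * φ j ^ 2 / 2) := by
        refine Finset.sum_le_sum fun i _ => Finset.sum_le_sum fun j _ => ?_
        have hweight := mul_nonneg (hπ.nonneg i) (nonneg_of_mem_rowStochastic hT (i := i) (j := j))
        nlinarith [mul_nonneg hweight (sq_nonneg (φ i - φ j))]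
    _ = ∑ i, π i * φ i ^ 2 := by
        simp_rw [Finset.sum_add_distrib, ← Finset.sum_div]
        rw [hfst, hsnd, add_halves]

theorem IsStationary.dotProduct_discounted_le (hπ : IsStationary T π) (hT : T ∈ rowStochastic ℝ S)
    {γ : ℝ} (hγ : 0 ≤ γ) (φ : S → ℝ) :
    φ ⬝ᵥ (π * (γ • T *ᵥ φ - φ)) ≤ -((1 - γ) * ∑ i, π i * φ i ^ 2) := by
  calc φ ⬝ᵥ (π * (γ • T *ᵥ φ - φ))
      = γ * ∑ i, π i * (φ i * (T *ᵥ φ) i) - ∑ i, π i * φ i ^ 2 := by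
        rw [dotProduct, Finset.mul_sum, ← Finset.sum_sub_distrib]
        refine Finset.sum_congr rfl fun i _ => ?_
        simp only [Pi.mul_apply, Pi.sub_apply, Pi.smul_apply, smul_eq_mul]
        ring
    _ ≤ -((1 - γ) * ∑ i, π i * φ i ^ 2) := by
        linarith [mul_le_mul_of_nonneg_left (hπ.sum_mul_mulVec_le hT φ) hγ]

theorem pow_mul_pow_apply_le {ε : ℝ} (hε : 0 ≤ ε) (hU : ∀ i j, 0 ≤ U i j)
    (h : ∀ i j, ε * U i j ≤ T i j) (n : ℕ) (i j : S) : ε ^ n * (U ^ n) i j ≤ (T ^ n) i j := by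
  induction n generalizing j with
  | zero => simp
  | succ n ih =>
    rw [pow_succ U, pow_succ T, mul_apply, mul_apply, Finset.mul_sum]
    refine Finset.sum_le_sum fun k _ => ?_
    calc ε ^ (n + 1) * ((U ^ n) i k * U k j) = ε ^ n * (U ^ n) i k * (ε * U k j) := by ring
      _ ≤ (T ^ n) i k * T k j :=
        mul_le_mul (ih k) (h k j) (mul_nonneg hε (hU k j))
          ((mul_nonneg (pow_nonneg hε n) (pow_apply_nonneg hU n i k)).trans (ih k))

theorem IsIrreducibleChain.exists_pos_le_pow_apply (hU : IsIrreducibleChain U) :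
    ∃ c : ℝ, 0 < c ∧ ∃ N : ℕ, ∀ i j, ∃ n ≤ N, c ≤ (U ^ n) i j := by
  choose n hn using hU
  rcases isEmpty_or_nonempty S with hS | hS
  · exact ⟨1, one_pos, 0, fun i => hS.elim i⟩
  obtain ⟨N, hN⟩ := (Set.finite_range (fun q : S × S => n q.1 q.2)).bddAbove
  obtain ⟨q, hq⟩ := Finite.exists_min (fun q : S × S => (U ^ n q.1 q.2) q.1 q.2)
  exact ⟨_, hn q.1 q.2, N, fun i j => ⟨n i j, hN ⟨(i, j), rfl⟩, hq (i, j)⟩⟩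

theorem IsIrreducibleChain.exists_stationary_ge (hirr : IsIrreducibleChain U)
    (hU : ∀ i j, 0 ≤ U i j) :
    ∃ c : ℝ, 0 < c ∧ ∃ N : ℕ, ∀ ε : ℝ, 0 < ε → ε ≤ 1 → ∀ T : Matrix S S ℝ,
      (∀ i j, ε * U i j ≤ T i j) → ∀ π, IsStationary T π → ∀ j, c * ε ^ N ≤ π j := by
  rcases isEmpty_or_nonempty S with hS | hS
  · exact ⟨1, one_pos, 0, fun _ _ _ _ _ _ _ j => hS.elim j⟩
  obtain ⟨c, hc, N, hN⟩ := hirr.exists_pos_le_pow_apply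
  have hcard : (0 : ℝ) < (Fintype.card S : ℝ)⁻¹ := inv_pos.2 (Nat.cast_pos.2 Fintype.card_pos)
  refine ⟨(Fintype.card S : ℝ)⁻¹ * c, mul_pos hcard hc, N, fun ε hε hε1 T hT π hπ j => ?_⟩
  obtain ⟨i, hi⟩ := hπ.exists_inv_card_le
  obtain ⟨n, hnN, hn⟩ := hN i j
  have hTnn : ∀ i j, 0 ≤ T i j := fun i j => (mul_nonneg hε.le (hU i j)).trans (hT i j)
  calc (Fintype.card S : ℝ)⁻¹ * c * ε ^ N = (Fintype.card S : ℝ)⁻¹ * (ε ^ N * c) := by ring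
    _ ≤ π i * (ε ^ n * (U ^ n) i j) := by
        refine mul_le_mul hi (mul_le_mul ?_ hn hc.le (by positivity)) (by positivity) (hπ.nonneg i)
        exact pow_le_pow_of_le_one hε.le hε1 hnN
    _ ≤ π i * (T ^ n) i j :=
        mul_le_mul_of_nonneg_left (pow_mul_pow_apply_le hε.le hU hT n i j) (hπ.nonneg i)
    _ ≤ π j := hπ.mul_pow_apply_le hTnn n i j

end StationaryLaw

section Compactness

variable {E F : Type*} [NormedAddCommGroup E] [NormedSpace ℝ E] [NormedAddCommGroup F]
  [NormedSpace ℝ F] {f : E → F} {s : Set E}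

theorem exists_norm_fderiv_le (hs : IsCompact s) (hf : ∀ x ∈ s, ContDiffAt ℝ 1 f x) :
    ∃ C, ∀ x ∈ s, ‖fderiv ℝ f x‖ ≤ C :=
  hs.exists_bound_of_continuousOn fun x hx =>
    ((hf x hx).fderiv_right (m := 0) (by norm_num)).continuousAt.continuousWithinAt

theorem exists_lipschitzOnWith_of_contDiffAt (hs : IsCompact s) (hconv : Convex ℝ s)
    (hf : ∀ x ∈ s, ContDiffAt ℝ 1 f x) : ∃ L, LipschitzOnWith L f s := by
  obtain ⟨C, hC⟩ := exists_norm_fderiv_le hs hf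
  exact ⟨C.toNNReal, hconv.lipschitzOnWith_of_nnnorm_fderiv_le
    (fun x hx => (hf x hx).differentiableAt one_ne_zero)
    fun x hx => NNReal.le_toNNReal_of_coe_le (hC x hx)⟩

end Compactness

section Policies

variable {X A : Type*} [Fintype A] {f : X × A → ℝ}

theorem IsPolicy.le_one (hf : IsPolicy f) (ξ : X × A) : f ξ ≤ 1 :=
  hf.sum_eq_one ξ.1 ▸
    Finset.single_le_sum (f := fun a => f (ξ.1, a)) (fun _ _ => hf.nonneg _) (Finset.mem_univ ξ.2)

theorem convex_setOf_isPolicy : Convex ℝ {f : X × A → ℝ | IsPolicy f} := by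
  intro f hf g hg a b ha hb hab
  refine ⟨fun ξ => ?_, fun x => ?_⟩
  · simpa using add_nonneg (mul_nonneg ha (hf.nonneg ξ)) (mul_nonneg hb (hg.nonneg ξ))
  · simp [Finset.sum_add_distrib, ← Finset.mul_sum, hf.sum_eq_one, hg.sum_eq_one, hab]

theorem isCompact_setOf_isPolicy : IsCompact {f : X × A → ℝ | IsPolicy f} := by
  have hset : {f : X × A → ℝ | IsPolicy f} = Set.Ici 0 ∩ ⋂ x, {f | ∑ a, f (x, a) = 1} := by
    ext f
    simp only [Set.mem_inter_iff, Set.mem_iInter]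
    exact ⟨fun hf => ⟨hf.nonneg, hf.sum_eq_one⟩, fun hf => ⟨hf.1, hf.2⟩⟩
  have hclosed : IsClosed {f : X × A → ℝ | IsPolicy f} :=
    hset ▸ isClosed_Ici.inter
      (isClosed_iInter fun x => isClosed_eq (by fun_prop) continuous_const)
  exact (isCompact_univ_pi fun _ => isCompact_Icc (a := 0) (b := 1)).of_isClosed_subset hclosed
    fun f hf ξ _ => ⟨hf.nonneg ξ, hf.le_one ξ⟩

end Policies

section Resolvent

open Matrix
open scoped Matrix.Norms.Operator

variable {X A : Type*} [Fintype X] [Fintype A]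

theorem MDP.nonempty (M : MDP X A) : Nonempty (X × A) := by
  by_contra h
  simpa [not_nonempty_iff.1 h] using M.ρ₀_sum

variable (M : MDP X A) {f : X × A → ℝ}

theorem MDP.one_sub_γ_pos : 0 < 1 - M.γ := sub_pos.2 M.γ_lt_one

/-- The transition matrix of the states, indexed by state-action pairs: the chain under the policy
`f` is `M.stateStep * diagonal f`. -/
def MDP.stateStep : Matrix (X × A) (X × A) ℝ := of fun ξ ξ' => M.p ξ.1 ξ.2 ξ'.1

theorem MDP.trans_mulVec (f φ : X × A → ℝ) : M.trans f *ᵥ φ = M.stateStep *ᵥ (f * φ) := by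
  funext ξ
  simp [mulVec, dotProduct, MDP.trans, MDP.stateStep, mul_assoc]

theorem MDP.vecMul_trans (f φ : X × A → ℝ) : φ ᵥ* M.trans f = (φ ᵥ* M.stateStep) * f := by
  funext ξ
  simp [vecMul, dotProduct, MDP.trans, MDP.stateStep, Finset.sum_mul, mul_assoc]

theorem MDP.contDiff_trans {n : WithTop ℕ∞} : ContDiff ℝ n M.trans :=
  (LinearMap.toContinuousLinearMap
    { toFun := M.trans
      map_add' := fun f g => by ext; simp [MDP.trans, mul_add]
      map_smul' := fun c f => by ext; simp [MDP.trans, mul_left_comm] } :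
    (X × A → ℝ) →L[ℝ] Matrix (X × A) (X × A) ℝ).contDiff

variable [DecidableEq X] [DecidableEq A]

theorem MDP.trans_mem_rowStochastic (hf : IsPolicy f) : M.trans f ∈ rowStochastic ℝ (X × A) := by
  refine mem_rowStochastic_iff_sum.2
    ⟨fun ξ ξ' => mul_nonneg (M.p_nonneg _ _ _) (hf.nonneg _), fun ξ => ?_⟩
  simp only [MDP.trans, of_apply, Fintype.sum_prod_type, ← Finset.mul_sum, hf.sum_eq_one, mul_one,
    M.p_sum]

theorem MDP.norm_smul_trans_lt_one (hf : IsPolicy f) : ‖M.γ • M.trans f‖ < 1 := by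
  rw [norm_smul, Real.norm_of_nonneg M.γ_pos.le]
  exact (mul_le_of_le_one_right M.γ_pos.le
    (linfty_opNorm_le_one_of_mem_rowStochastic (M.trans_mem_rowStochastic hf))).trans_lt M.γ_lt_one

theorem MDP.eventually_norm_smul_trans_lt_one (hf : IsPolicy f) :
    ∀ᶠ g in 𝓝 f, ‖M.γ • M.trans g‖ < 1 :=
  ((M.contDiff_trans (n := 0)).continuous.const_smul M.γ).norm.continuousAt.eventually_lt_const
    (M.norm_smul_trans_lt_one hf)

/-- The resolvent `(1 - γ T)⁻¹` of the state-action chain. It turns the two discounted series of the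
model into linear algebra, also for `f` slightly outside the set of policies. -/
def MDP.resolvent (f : X × A → ℝ) : Matrix (X × A) (X × A) ℝ := Ring.inverse (1 - M.γ • M.trans f)

theorem MDP.resolvent_mul (h : ‖M.γ • M.trans f‖ < 1) :
    M.resolvent f * (1 - M.γ • M.trans f) = 1 :=
  Ring.inverse_mul_cancel _ (isUnit_one_sub_of_norm_lt_one h)

theorem MDP.mul_resolvent (h : ‖M.γ • M.trans f‖ < 1) :
    (1 - M.γ • M.trans f) * M.resolvent f = 1 :=
  Ring.mul_inverse_cancel _ (isUnit_one_sub_of_norm_lt_one h)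

theorem MDP.hasSum_resolvent_apply (h : ‖M.γ • M.trans f‖ < 1) (ξ ξ' : X × A) :
    HasSum (fun k => M.γ ^ k * (M.trans f ^ k) ξ ξ') (M.resolvent f ξ ξ') := by
  simpa [smul_pow, MDP.resolvent] using!
    Pi.hasSum.1 (Pi.hasSum.1 (hasSum_geom_series_inverse (M.γ • M.trans f) h) ξ) ξ'

theorem MDP.actionValue_eq_resolvent_mulVec (h : ‖M.γ • M.trans f‖ < 1) :
    M.actionValue f = M.resolvent f *ᵥ M.r := by
  funext ξ
  refine HasSum.tsum_eq ?_
  simp only [mulVec, dotProduct, Finset.mul_sum, ← mul_assoc]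
  exact hasSum_sum fun ξ' _ => (M.hasSum_resolvent_apply h ξ ξ').mul_right _

theorem MDP.visiting_eq_vecMul_resolvent (h : ‖M.γ • M.trans f‖ < 1) :
    M.visiting f = (fun ξ => M.initState ξ.1 * f ξ) ᵥ* M.resolvent f := by
  funext ξ
  refine HasSum.tsum_eq ?_
  simp only [MDP.law, vecMul, dotProduct, Finset.mul_sum, mul_left_comm (M.γ ^ _)]
  exact hasSum_sum fun ξ' _ => (M.hasSum_resolvent_apply h ξ' ξ).mul_left _

theorem MDP.contDiffAt_resolvent_apply {n : WithTop ℕ∞} (hf : IsPolicy f) (ξ ξ' : X × A) :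
    ContDiffAt ℝ n (fun g => M.resolvent g ξ ξ') f := by
  obtain ⟨u, hu⟩ := isUnit_one_sub_of_norm_lt_one (M.norm_smul_trans_lt_one hf)
  have hinv : ContDiffAt ℝ n M.resolvent f :=
    ContDiffAt.comp f (hu ▸ contDiffAt_ringInverse ℝ u)
      (contDiff_const.sub (M.contDiff_trans.const_smul M.γ)).contDiffAt
  exact (LinearMap.toContinuousLinearMap (entryLinearMap ℝ ℝ ξ ξ')).contDiff.contDiffAt.comp f hinv

theorem MDP.contDiffAt_actionValue {n : WithTop ℕ∞} (hf : IsPolicy f) :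
    ContDiffAt ℝ n M.actionValue f := by
  refine ContDiffAt.congr_of_eventuallyEq (f := fun g => M.resolvent g *ᵥ M.r) ?_
    ((M.eventually_norm_smul_trans_lt_one hf).mono fun g => M.actionValue_eq_resolvent_mulVec)
  exact contDiffAt_pi.2 fun ξ =>
    ContDiffAt.sum fun ξ' _ => (M.contDiffAt_resolvent_apply hf ξ ξ').mul contDiffAt_const

theorem MDP.contDiffAt_visiting {n : WithTop ℕ∞} (hf : IsPolicy f) :
    ContDiffAt ℝ n M.visiting f := by
  refine ContDiffAt.congr_of_eventuallyEq
    (f := fun g => (fun ξ => M.initState ξ.1 * g ξ) ᵥ* M.resolvent g) ?_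
    ((M.eventually_norm_smul_trans_lt_one hf).mono fun g => M.visiting_eq_vecMul_resolvent)
  exact contDiffAt_pi.2 fun ξ => ContDiffAt.sum fun ξ' _ =>
    (contDiffAt_const.mul (contDiffAt_apply ..)).mul (M.contDiffAt_resolvent_apply hf ξ' ξ)

theorem MDP.eventually_bellman (hf : IsPolicy f) :
    M.actionValue =ᶠ[𝓝 f] fun g => M.r + M.γ • M.stateStep *ᵥ (g * M.actionValue g) := by
  filter_upwards [M.eventually_norm_smul_trans_lt_one hf] with g hg
  have hcancel : (1 - M.γ • M.trans g) *ᵥ M.actionValue g = M.r := by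
    rw [M.actionValue_eq_resolvent_mulVec hg, mulVec_mulVec, M.mul_resolvent hg, one_mulVec]
  rw [sub_mulVec, one_mulVec, smul_mulVec, trans_mulVec] at hcancel
  exact eq_add_of_sub_eq hcancel

theorem MDP.actionValue_eq (hf : IsPolicy f) :
    M.actionValue f = M.r + M.γ • M.stateStep *ᵥ (f * M.actionValue f) :=
  (M.eventually_bellman hf).self_of_nhds

/-- The discounted visiting measure of the states. -/
def MDP.stateVisiting (f : X × A → ℝ) (x : X) : ℝ :=
  M.initState x + M.γ * ∑ ξ, M.visiting f ξ * M.p ξ.1 ξ.2 x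

theorem MDP.visiting_eq_stateVisiting_mul (hf : IsPolicy f) :
    M.visiting f = (fun ξ => M.stateVisiting f ξ.1) * f := by
  have hnorm := M.norm_smul_trans_lt_one hf
  have hcancel : M.visiting f ᵥ* (1 - M.γ • M.trans f) = fun ξ => M.initState ξ.1 * f ξ := by
    rw [M.visiting_eq_vecMul_resolvent hnorm, vecMul_vecMul, M.resolvent_mul hnorm, vecMul_one]
  rw [vecMul_sub, vecMul_one, vecMul_smul, vecMul_trans, sub_eq_iff_eq_add] at hcancel
  rw [hcancel]
  funext ξ
  simp [MDP.stateVisiting, MDP.stateStep, vecMul, dotProduct, add_mul, mul_assoc]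

end Resolvent

section Softmax

variable {X A : Type*} [Fintype A]

theorem sum_exp_pos [Nonempty A] (P : X × A → ℝ) (x : X) : 0 < ∑ a, Real.exp (P (x, a)) :=
  Finset.sum_pos (fun _ _ => Real.exp_pos _) Finset.univ_nonempty

theorem isPolicy_softmax [Nonempty A] (P : X × A → ℝ) : IsPolicy (softmax P) where
  nonneg ξ := div_nonneg (Real.exp_pos _).le (sum_exp_pos P ξ.1).le
  sum_eq_one x := by simp only [softmax, ← Finset.sum_div, div_self (sum_exp_pos P x).ne']

/-- The derivative of the softmax policy with respect to the logits. -/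
def softmaxDeriv (P : X × A → ℝ) : (X × A → ℝ) →L[ℝ] X × A → ℝ :=
  ContinuousLinearMap.pi fun ξ => softmax P ξ • (ContinuousLinearMap.proj ξ -
    ∑ a, softmax P (ξ.1, a) • ContinuousLinearMap.proj (R := ℝ) (φ := fun _ : X × A => ℝ) (ξ.1, a))

theorem softmaxDeriv_apply (P k : X × A → ℝ) (ξ : X × A) :
    softmaxDeriv P k ξ = softmax P ξ * (k ξ - ∑ a, softmax P (ξ.1, a) * k (ξ.1, a)) := by
  simp [softmaxDeriv]

/-- The part of `h` that is visible to perturbations of the policy `f` in the logits: the total mass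
of `h` at each state, redistributed according to `f`, is subtracted. -/
def center (f h : X × A → ℝ) (ξ : X × A) : ℝ := h ξ - f ξ * ∑ a, h (ξ.1, a)

theorem center_sub (f h k : X × A → ℝ) : center f (h - k) = center f h - center f k := by
  funext ξ
  simp only [center, Pi.sub_apply, Finset.sum_sub_distrib]
  ring

theorem hasFDerivAt_softmax [Finite X] [Nonempty A] (P : X × A → ℝ) :
    HasFDerivAt softmax (softmaxDeriv P) P := by
  have := Fintype.ofFinite X
  refine hasFDerivAt_pi.2 fun ξ => ?_
  have hexp (ζ : X × A) : HasFDerivAt (fun P' : X × A → ℝ => Real.exp (P' ζ)) _ P :=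
    (hasFDerivAt_apply ζ P).exp
  have hsum : HasFDerivAt (fun P' : X × A → ℝ => ∑ a, Real.exp (P' (ξ.1, a))) _ P :=
    HasFDerivAt.fun_sum fun a _ => hexp (ξ.1, a)
  have hne := (sum_exp_pos P ξ.1).ne'
  refine ((hexp ξ).mul ((hasDerivAt_inv hne).comp_hasFDerivAt P hsum)).congr_fderiv
    (ContinuousLinearMap.ext fun k => ?_)
  simp only [softmax, add_apply, sub_apply, smul_apply, sum_apply, Function.comp_apply,
    ContinuousLinearMap.proj_apply, smul_eq_mul]
  simp_rw [div_mul_eq_mul_div]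
  rw [← Finset.sum_div]
  field_simp
  ring

variable [Fintype X]

theorem IsPolicy.abs_sum_mul_le {f : X × A → ℝ} (hf : IsPolicy f) (k : X × A → ℝ) (x : X) :
    |∑ a, f (x, a) * k (x, a)| ≤ ‖k‖ := by
  calc |∑ a, f (x, a) * k (x, a)| ≤ ∑ a, |f (x, a) * k (x, a)| := Finset.abs_sum_le_sum_abs _ _
    _ ≤ ∑ a, f (x, a) * ‖k‖ := Finset.sum_le_sum fun a _ => by
        rw [abs_mul, abs_of_nonneg (hf.nonneg _)]
        exact mul_le_mul_of_nonneg_left (norm_le_pi_norm k _) (hf.nonneg _)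
    _ = ‖k‖ := by rw [← Finset.sum_mul, hf.sum_eq_one, one_mul]

theorem norm_softmaxDeriv_apply_le [Nonempty A] (P k : X × A → ℝ) :
    ‖softmaxDeriv P k‖ ≤ 2 * ‖k‖ := by
  have hf := isPolicy_softmax P
  refine (pi_norm_le_iff_of_nonneg (by positivity)).2 fun ξ => ?_
  rw [softmaxDeriv_apply, norm_mul, Real.norm_of_nonneg (hf.nonneg ξ)]
  calc softmax P ξ * ‖k ξ - ∑ a, softmax P (ξ.1, a) * k (ξ.1, a)‖
      ≤ ‖k ξ - ∑ a, softmax P (ξ.1, a) * k (ξ.1, a)‖ :=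
        mul_le_of_le_one_left (norm_nonneg _) (hf.le_one ξ)
    _ ≤ ‖k‖ + ‖k‖ := norm_sub_le_of_le (norm_le_pi_norm k ξ) (hf.abs_sum_mul_le k ξ.1)
    _ = 2 * ‖k‖ := (two_mul _).symm

theorem lipschitzWith_softmax [Nonempty A] :
    LipschitzWith 2 (softmax : (X × A → ℝ) → X × A → ℝ) := by
  refine lipschitzWith_of_nnnorm_fderiv_le
    (fun P => (hasFDerivAt_softmax P).differentiableAt) fun P => ?_
  rw [(hasFDerivAt_softmax P).fderiv]
  exact ContinuousLinearMap.opNorm_le_bound _ zero_le_two (norm_softmaxDeriv_apply_le P)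

theorem sum_mul_sub_sum_eq_dotProduct_center (f h k : X × A → ℝ) :
    ∑ ξ, h ξ * (k ξ - ∑ a, f (ξ.1, a) * k (ξ.1, a)) = k ⬝ᵥ center f h := by
  simp only [center, dotProduct, mul_sub, Finset.sum_sub_distrib]
  congr 1
  · exact Finset.sum_congr rfl fun _ _ => mul_comm _ _
  · simp only [Fintype.sum_prod_type, Finset.mul_sum, ← mul_assoc]
    exact Finset.sum_congr rfl fun x _ => Finset.sum_comm.trans <|
      Finset.sum_congr rfl fun a _ => Finset.sum_congr rfl fun b _ => by ring

theorem IsPolicy.norm_center_le {f : X × A → ℝ} (hf : IsPolicy f) (h : X × A → ℝ) :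
    ‖center f h‖ ≤ (1 + Fintype.card A) * ‖h‖ := by
  refine (pi_norm_le_iff_of_nonneg (by positivity)).2 fun ξ => ?_
  calc ‖center f h ξ‖ ≤ ‖h ξ‖ + f ξ * ‖∑ a, h (ξ.1, a)‖ := by
        refine (norm_sub_le _ _).trans_eq ?_
        rw [norm_mul, Real.norm_of_nonneg (hf.nonneg ξ)]
    _ ≤ ‖h‖ + 1 * ∑ _a : A, ‖h‖ := by
        gcongr
        · exact norm_le_pi_norm h ξ
        · exact hf.le_one ξ
        · exact norm_sum_le_of_le _ fun a _ => norm_le_pi_norm h _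
    _ = (1 + Fintype.card A) * ‖h‖ := by simp [add_mul]

end Softmax

section PolicyGradient

open Matrix

variable {X A : Type*} [Fintype X] [Fintype A] [DecidableEq X] [DecidableEq A] (M : MDP X A)
  {f : X × A → ℝ}

theorem MDP.objective_eq_dotProduct (f : X × A → ℝ) :
    M.objective f = (fun ξ => M.initState ξ.1) ⬝ᵥ (f * M.actionValue f) := by
  simp [MDP.objective, MDP.stateValue, dotProduct, Fintype.sum_prod_type, Finset.mul_sum]

theorem MDP.differentiableAt_objective (hf : IsPolicy f) : DifferentiableAt ℝ M.objective f := by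
  have hV := (M.contDiffAt_actionValue (n := 1) hf).differentiableAt one_ne_zero
  simp_rw [funext M.objective_eq_dotProduct, dotProduct]
  fun_prop

theorem MDP.fderiv_objective_apply (hf : IsPolicy f) (h : X × A → ℝ) :
    fderiv ℝ M.objective f h = (fun ξ => M.stateVisiting f ξ.1) ⬝ᵥ (h * M.actionValue f) := by
  have hV := ((M.contDiffAt_actionValue (n := 1) hf).differentiableAt one_ne_zero).hasFDerivAt
  have hU := (hasFDerivAt_id f).mul hV
  set V' := fderiv ℝ M.actionValue f h
  have hbellman : V' = M.γ • M.stateStep *ᵥ (h * M.actionValue f + f * V') := by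
    have hstep := (((LinearMap.toContinuousLinearMap M.stateStep.mulVecLin).hasFDerivAt.comp f
      hU).const_smul M.γ).const_add M.r
    have hunique := hV.unique (hstep.congr_of_eventuallyEq (M.eventually_bellman hf))
    refine (DFunLike.congr_fun hunique h).trans ?_
    simp [V', mul_comm, add_comm, mulVec_add]
  have hJ : fderiv ℝ M.objective f h =
      (fun ξ => M.initState ξ.1) ⬝ᵥ (h * M.actionValue f + f * V') := by
    have hlin := (LinearMap.toContinuousLinearMap
      (dotProductBilin ℝ ℝ fun ξ : X × A => M.initState ξ.1)).hasFDerivAt.comp f hU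
    rw [(hlin.congr_of_eventuallyEq (.of_forall M.objective_eq_dotProduct)).fderiv]
    simp [V', mul_comm, add_comm]
  have hcross : (M.γ • M.visiting f ᵥ* M.stateStep) ⬝ᵥ (h * M.actionValue f + f * V') =
      (fun ξ => M.stateVisiting f ξ.1) ⬝ᵥ (f * V') := by
    rw [smul_dotProduct, ← dotProduct_mulVec, ← dotProduct_smul, ← hbellman,
      M.visiting_eq_stateVisiting_mul hf]
    simp only [dotProduct, Pi.mul_apply, mul_assoc]
  rw [hJ, eq_comm, ← add_right_cancel_iff, ← dotProduct_add, ← hcross, ← add_dotProduct]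
  rfl

/-- The policy gradient of the softmax parametrisation, as a function of the policy. -/
def MDP.softmaxGradient (f : X × A → ℝ) : X × A → ℝ := center f (M.visiting f * M.actionValue f)

theorem MDP.hasFDerivAt_objective_softmax (P : X × A → ℝ) :
    HasFDerivAt (fun P' => M.objective (softmax P'))
      ((fderiv ℝ M.objective (softmax P)).comp (softmaxDeriv P)) P := by
  have := M.nonempty.map Prod.snd
  exact (M.differentiableAt_objective (isPolicy_softmax P)).hasFDerivAt.comp P
    (hasFDerivAt_softmax P)

theorem MDP.fderiv_objective_softmax_apply (P k : X × A → ℝ) :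
    fderiv ℝ (fun P' => M.objective (softmax P')) P k = k ⬝ᵥ M.softmaxGradient (softmax P) := by
  have := M.nonempty.map Prod.snd
  have hf := isPolicy_softmax P
  rw [(M.hasFDerivAt_objective_softmax P).fderiv, ContinuousLinearMap.comp_apply,
    M.fderiv_objective_apply hf, MDP.softmaxGradient, ← sum_mul_sub_sum_eq_dotProduct_center]
  refine Finset.sum_congr rfl fun ξ _ => ?_
  simp only [Pi.mul_apply, softmaxDeriv_apply, M.visiting_eq_stateVisiting_mul hf]
  ring

theorem MDP.policyGradient_eq (P : X × A → ℝ) :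
    M.policyGradient P = M.softmaxGradient (softmax P) := by
  funext ξ
  rw [MDP.policyGradient, M.fderiv_objective_softmax_apply, single_one_dotProduct]

theorem MDP.contDiffAt_softmaxGradient {n : WithTop ℕ∞} (hf : IsPolicy f) :
    ContDiffAt ℝ n M.softmaxGradient f := by
  have hσ := contDiffAt_pi.1 (M.contDiffAt_visiting (n := n) hf)
  have hV := contDiffAt_pi.1 (M.contDiffAt_actionValue (n := n) hf)
  exact contDiffAt_pi.2 fun ξ => ((hσ ξ).mul (hV ξ)).sub
    ((contDiffAt_apply ..).mul (ContDiffAt.sum fun a _ => (hσ (ξ.1, a)).mul (hV (ξ.1, a))))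

theorem MDP.exists_norm_softmaxGradient_le :
    ∃ C, ∀ f, IsPolicy f → ‖M.softmaxGradient f‖ ≤ C :=
  isCompact_setOf_isPolicy.exists_bound_of_continuousOn fun _ hf =>
    (M.contDiffAt_softmaxGradient (n := 0) hf).continuousAt.continuousWithinAt

theorem MDP.exists_lipschitzOnWith_softmaxGradient :
    ∃ L, LipschitzOnWith L M.softmaxGradient {f | IsPolicy f} :=
  exists_lipschitzOnWith_of_contDiffAt isCompact_setOf_isPolicy convex_setOf_isPolicy
    fun _ hf => M.contDiffAt_softmaxGradient hf

theorem MDP.exists_objective_le : ∃ C, ∀ f, IsPolicy f → M.objective f ≤ C := by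
  obtain ⟨C, hC⟩ := isCompact_setOf_isPolicy.exists_bound_of_continuousOn
    fun f hf => (M.differentiableAt_objective (f := f) hf).continuousAt.continuousWithinAt
  exact ⟨C, fun f hf => (le_abs_self _).trans (hC f hf)⟩

end PolicyGradient

section Barrier

open Filter

theorem exists_eventually_le_mul_of_deriv_le {Y Y' B B' a b : ℝ → ℝ}
    (hY : ∀ᶠ t in atTop, HasDerivAt Y (Y' t) t) (hY' : ∀ᶠ t in atTop, Y' t ≤ b t - a t * Y t)
    (hB : ∀ᶠ t in atTop, HasDerivAt B (B' t) t) (hB' : ∀ᶠ t in atTop, b t - a t * B t < B' t)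
    (hBpos : ∀ᶠ t in atTop, 0 < B t) (hb : ∀ᶠ t in atTop, 0 ≤ b t) :
    ∃ K, ∀ᶠ t in atTop, Y t ≤ K * B t := by
  obtain ⟨T, hT⟩ :=
    (hY.and <| hY'.and <| hB.and <| hB'.and <| hBpos.and hb).exists_forall_of_atTop
  choose hY hY' hB hB' hBpos hb using hT
  refine ⟨max 1 (Y T / B T), (eventually_ge_atTop T).mono fun t ht => ?_⟩
  refine image_le_of_deriv_right_lt_deriv_boundary' (f' := Y')
    (B' := fun s => max 1 (Y T / B T) * B' s)
    (fun s hs => (hY s hs.1).continuousAt.continuousWithinAt)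
    (fun s hs => (hY s hs.1).hasDerivWithinAt) ((div_le_iff₀ (hBpos T le_rfl)).1 (le_max_right _ _))
    (fun s hs => ((hB s hs.1).const_mul _).continuousAt.continuousWithinAt)
    (fun s hs => ((hB s hs.1).const_mul _).hasDerivWithinAt) (fun s hs heq => ?_) ⟨ht, le_rfl⟩
  have hK : 1 ≤ max 1 (Y T / B T) := le_max_left _ _
  calc Y' s ≤ b s - a s * (max 1 (Y T / B T) * B s) := heq ▸ hY' s hs.1
    _ ≤ max 1 (Y T / B T) * (b s - a s * B s) := by
      linarith [le_mul_of_one_le_left (hb s hs.1) hK]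
    _ < max 1 (Y T / B T) * B' s :=
      mul_lt_mul_of_pos_left (hB' s hs.1) (zero_lt_one.trans_le hK)

end Barrier

section Lyapunov

open Matrix

theorem exists_lyapunov_deriv_le {S : Type*} [Fintype S] [DecidableEq S] {K : Matrix S S ℝ}
    (hK : K.PosDef) :
    ∃ b > 0, ∀ (φ w v : S → ℝ) (μ : ℝ), 0 < μ → φ ⬝ᵥ w ≤ -(μ * ‖φ‖ ^ 2) →
      2 * φ ⬝ᵥ K⁻¹ *ᵥ (K *ᵥ w + v) ≤ (b * ‖v‖) ^ 2 / μ - μ / b * φ ⬝ᵥ K⁻¹ *ᵥ φ := by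
  obtain ⟨b, hb, hupper⟩ := exists_abs_dotProduct_mulVec_le K⁻¹
  refine ⟨b, hb, fun φ w v μ hμ hw => ?_⟩
  have hcancel : K⁻¹ *ᵥ (K *ᵥ w + v) = w + K⁻¹ *ᵥ v := by
    rw [mulVec_add, mulVec_mulVec, nonsing_inv_mul _ ((isUnit_iff_isUnit_det _).1 hK.isUnit),
      one_mulVec]
  have hdrift : φ ⬝ᵥ K⁻¹ *ᵥ v ≤ b * (‖φ‖ * ‖v‖) := (le_abs_self _).trans (hupper _ _)
  have henergy : μ / b * φ ⬝ᵥ K⁻¹ *ᵥ φ ≤ μ * ‖φ‖ ^ 2 :=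
    calc μ / b * φ ⬝ᵥ K⁻¹ *ᵥ φ ≤ μ / b * (b * (‖φ‖ * ‖φ‖)) := by
          gcongr
          exact (le_abs_self _).trans (hupper _ _)
      _ = μ * ‖φ‖ ^ 2 := by field_simp
  have hyoung : 2 * (b * (‖φ‖ * ‖v‖)) ≤ μ * ‖φ‖ ^ 2 + (b * ‖v‖) ^ 2 / μ := by
    have hsq : 0 ≤ (μ * ‖φ‖ - b * ‖v‖) ^ 2 / μ := by positivity
    have hexpand : (μ * ‖φ‖ - b * ‖v‖) ^ 2 / μ =
        μ * ‖φ‖ ^ 2 + (b * ‖v‖) ^ 2 / μ - 2 * (b * (‖φ‖ * ‖v‖)) := by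
      field_simp
      ring
    linarith
  rw [hcancel, dotProduct_add]
  linarith

end Lyapunov

section ExplorationRate

open Filter Matrix

theorem eta_pos (t : ℝ) : 0 < eta t := by unfold eta; positivity

theorem eta_le_one (t : ℝ) : eta t ≤ 1 :=
  div_le_one_of_le₀ (le_add_of_nonneg_right (sq_nonneg _)) (by positivity)

theorem hasDerivAt_eta {t : ℝ} (ht : -1 < t) :
    HasDerivAt eta (-(2 * Real.log (t + 1) * eta t ^ 2 / (1 + t))) t := by
  have hlog : HasDerivAt (fun s : ℝ => Real.log (s + 1)) (1 / (t + 1)) t :=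
    ((hasDerivAt_id t).add_const 1).log (by simpa using (neg_lt_iff_pos_add.1 ht).ne')
  have hpos : 0 < 1 + Real.log (t + 1) ^ 2 := by positivity
  convert! (hasDerivAt_const t (1 : ℝ)).fun_div ((hlog.fun_pow 2).const_add 1) hpos.ne' using 1
  simp only [eta]
  field_simp
  ring

theorem abs_deriv_eta_le {t : ℝ} (ht : -1 < t) : |deriv eta t| ≤ eta t / (1 + t) := by
  have ht' : 0 < 1 + t := by linarith
  have hamgm : 2 * |Real.log (t + 1)| ≤ 1 + Real.log (t + 1) ^ 2 := by
    nlinarith [sq_nonneg (|Real.log (t + 1)| - 1), sq_abs (Real.log (t + 1))]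
  have heta : (1 + Real.log (t + 1) ^ 2) * eta t = 1 := mul_one_div_cancel (by positivity)
  rw [(hasDerivAt_eta ht).deriv, abs_neg, abs_div, abs_of_pos ht', abs_mul, abs_mul, abs_two,
    abs_of_pos (pow_pos (eta_pos t) 2)]
  gcongr
  calc 2 * |Real.log (t + 1)| * eta t ^ 2 ≤ (1 + Real.log (t + 1) ^ 2) * eta t ^ 2 := by gcongr
    _ = eta t := by rw [sq (eta t), ← mul_assoc, heta, one_mul]

theorem tendsto_inv_eta_pow_div (n : ℕ) :
    Tendsto (fun t => (eta t ^ n)⁻¹ / (1 + t)) atTop (𝓝 0) := by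
  have hshift : Tendsto (fun t : ℝ => t + 1) atTop atTop :=
    tendsto_atTop_add_const_right _ 1 tendsto_id
  have hlog : (fun s => 1 ^ 2 + Real.log s ^ 2) =O[atTop] fun s => Real.log s ^ 2 :=
    (Real.isLittleO_const_log_atTop.isBigO.pow 2).add (Asymptotics.isBigO_refl _ _)
  have hpow : (fun s => (1 ^ 2 + Real.log s ^ 2) ^ n) =o[atTop] id :=
    (hlog.pow n).trans_isLittleO <| by
      simpa only [← pow_mul] using Real.isLittleO_pow_log_id_atTop (n := 2 * n)
  refine (hpow.tendsto_div_nhds_zero.comp hshift).congr fun t => ?_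
  simp [eta, add_comm]

theorem eventually_eta_sq_barrier {c C : ℝ} (hc : 0 < c) (hC : 0 ≤ C) (n : ℕ) :
    ∀ᶠ t in atTop, C / (eta t ^ n * (1 + t) ^ 2) - c * eta t ^ n * eta t ^ 2
      < 2 * eta t * deriv eta t := by
  have hsmall := (tendsto_inv_eta_pow_div (2 * n + 2)).eventually_lt_const
    (div_pos hc (by positivity : 0 < C + 2))
  filter_upwards [hsmall, eventually_ge_atTop 0] with t ht ht0
  have hη := eta_pos t
  have hη1 := eta_le_one t
  have hderiv := (abs_le.1 (abs_deriv_eta_le (by linarith : -1 < t))).1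
  have hmain : (C + 2) / (eta t ^ n * (1 + t)) < c * eta t ^ n * eta t ^ 2 := by
    rw [inv_eq_one_div, div_div, div_lt_div_iff₀ (by positivity) (by positivity)] at ht
    rw [div_lt_iff₀ (by positivity)]
    calc C + 2 = 1 * (C + 2) := (one_mul _).symm
      _ < c * (eta t ^ (2 * n + 2) * (1 + t)) := ht
      _ = c * eta t ^ n * eta t ^ 2 * (eta t ^ n * (1 + t)) := by ring
  have hforce : C / (eta t ^ n * (1 + t) ^ 2) ≤ C / (eta t ^ n * (1 + t)) := by
    gcongr
    nlinarith
  have hdrift : 2 * eta t * (eta t / (1 + t)) ≤ 2 / (eta t ^ n * (1 + t)) := by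
    rw [← mul_div_assoc, div_le_div_iff₀ (by positivity) (by positivity)]
    have : eta t ^ (n + 2) ≤ 1 := pow_le_one₀ hη.le hη1
    calc 2 * eta t * eta t * (eta t ^ n * (1 + t)) = 2 * (eta t ^ (n + 2) * (1 + t)) := by ring
      _ ≤ 2 * (1 + t) := by nlinarith
  rw [add_div] at hmain
  nlinarith [mul_le_mul_of_nonneg_left hderiv hη.le]

theorem isBigO_eta_of_damped {S : Type*} [Fintype S] {K : Matrix S S ℝ} (hK : K.PosDef)
    {φ w v : ℝ → S → ℝ} {c D : ℝ} (hc : 0 < c) (n : ℕ)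
    (hφ : ∀ᶠ t in atTop, HasDerivAt φ (K *ᵥ w t + v t) t)
    (hw : ∀ᶠ t in atTop, φ t ⬝ᵥ w t ≤ -(c * eta t ^ n * ‖φ t‖ ^ 2))
    (hv : ∀ᶠ t in atTop, ‖v t‖ ≤ D / (1 + t)) : φ =O[atTop] eta := by
  classical
  obtain ⟨m, hm, hlower⟩ := exists_pos_mul_norm_sq_le_of_posDef hK.inv
  obtain ⟨b, hb, henergy⟩ := exists_lyapunov_deriv_le hK
  have hY : ∀ᶠ t in atTop, HasDerivAt (fun s => φ s ⬝ᵥ K⁻¹ *ᵥ φ s)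
      (2 * φ t ⬝ᵥ K⁻¹ *ᵥ (K *ᵥ w t + v t)) t := hφ.mono fun t ht =>
    hasDerivAt_dotProduct_mulVec_self (isHermitian_iff_isSymm.1 hK.inv.isHermitian) ht
  have hY' : ∀ᶠ t in atTop, 2 * φ t ⬝ᵥ K⁻¹ *ᵥ (K *ᵥ w t + v t) ≤
      (b * D) ^ 2 / c / (eta t ^ n * (1 + t) ^ 2) - c / b * eta t ^ n * φ t ⬝ᵥ K⁻¹ *ᵥ φ t := by
    filter_upwards [hw, hv] with t hw hv
    have hη := eta_pos t
    calc 2 * φ t ⬝ᵥ K⁻¹ *ᵥ (K *ᵥ w t + v t)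
        ≤ (b * ‖v t‖) ^ 2 / (c * eta t ^ n) - c * eta t ^ n / b * φ t ⬝ᵥ K⁻¹ *ᵥ φ t :=
          henergy _ _ _ _ (by positivity) hw
      _ ≤ (b * (D / (1 + t))) ^ 2 / (c * eta t ^ n) - c * eta t ^ n / b * φ t ⬝ᵥ K⁻¹ *ᵥ φ t := by
          gcongr
      _ = _ := by generalize 1 + t = s; ring
  obtain ⟨C, hC⟩ := exists_eventually_le_mul_of_deriv_le hY hY'
    ((eventually_gt_atTop (-1)).mono fun t ht =>
      (hasDerivAt_eta ht).differentiableAt.hasDerivAt.fun_pow 2)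
    (by simpa using eventually_eta_sq_barrier (div_pos hc hb) (by positivity) n)
    (.of_forall fun t => pow_pos (eta_pos t) 2)
    (.of_forall fun t => by have := eta_pos t; positivity)
  refine Asymptotics.IsBigO.of_bound (√(C / m)) (hC.mono fun t ht => ?_)
  rw [Real.norm_of_nonneg (eta_pos t).le, ← Real.sqrt_sq (eta_pos t).le,
    ← Real.sqrt_mul' _ (sq_nonneg _)]
  refine Real.le_sqrt_of_sq_le ?_
  rw [div_mul_eq_mul_div, le_div_iff₀' hm]
  exact (hlower _).trans ht

end ExplorationRate

section Exploration

variable {X A : Type*} [Fintype A]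

/-- The policy that selects all actions with the same probability. -/
def uniformPolicy : X × A → ℝ := fun _ => (Fintype.card A : ℝ)⁻¹

theorem isPolicy_uniformPolicy [Nonempty A] : IsPolicy (uniformPolicy : X × A → ℝ) where
  nonneg _ := by unfold uniformPolicy; positivity
  sum_eq_one _ := by simp [uniformPolicy]

theorem explore_eq (t : ℝ) (P : X × A → ℝ) :
    explore t P = eta t • uniformPolicy + (1 - eta t) • softmax P := by
  funext ξ
  simp [explore, uniformPolicy, div_eq_mul_inv]

theorem isPolicy_explore [Nonempty A] (t : ℝ) (P : X × A → ℝ) : IsPolicy (explore t P) :=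
  explore_eq t P ▸ convex_setOf_isPolicy isPolicy_uniformPolicy (isPolicy_softmax P)
    (eta_pos t).le (sub_nonneg.2 (eta_le_one t)) (add_sub_cancel _ _)

theorem IsPolicy.eta_div_card_mul_le_explore [Nonempty A] {f : X × A → ℝ} (hf : IsPolicy f) (t : ℝ)
    (P : X × A → ℝ) (ξ : X × A) : eta t / Fintype.card A * f ξ ≤ explore t P ξ :=
  calc eta t / Fintype.card A * f ξ ≤ eta t / Fintype.card A :=
        mul_le_of_le_one_right (div_nonneg (eta_pos t).le (Nat.cast_nonneg _)) (hf.le_one ξ)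
    _ ≤ explore t P ξ := le_add_of_nonneg_right <|
        mul_nonneg (sub_nonneg.2 (eta_le_one t)) ((isPolicy_softmax P).nonneg ξ)

variable [Fintype X]

theorem IsPolicy.norm_sub_le_one {f g : X × A → ℝ} (hf : IsPolicy f) (hg : IsPolicy g) :
    ‖f - g‖ ≤ 1 :=
  (pi_norm_le_iff_of_nonneg zero_le_one).2 fun ξ => abs_sub_le_of_nonneg_of_le
    (hf.nonneg ξ) (hf.le_one ξ) (hg.nonneg ξ) (hg.le_one ξ)

theorem norm_explore_sub_softmax_le [Nonempty A] (t : ℝ) (P : X × A → ℝ) :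
    ‖explore t P - softmax P‖ ≤ eta t := by
  have hdiff : explore t P - softmax P = eta t • (uniformPolicy - softmax P) := by
    rw [explore_eq]
    module
  rw [hdiff, norm_smul, Real.norm_of_nonneg (eta_pos t).le]
  exact mul_le_of_le_one_right (eta_pos t).le
    (isPolicy_uniformPolicy.norm_sub_le_one (isPolicy_softmax P))

theorem exists_hasDerivAt_explore [Nonempty A] {P : ℝ → X × A → ℝ} {P' : X × A → ℝ} {t : ℝ}
    (ht : -1 < t) (hP : HasDerivAt P P' t) :
    ∃ g', HasDerivAt (fun s => explore s (P s)) g' t ∧ ‖g'‖ ≤ 1 / (1 + t) + 2 * ‖P'‖ := by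
  have hη := (hasDerivAt_eta ht).differentiableAt.hasDerivAt
  have hf : HasDerivAt (fun s => softmax (P s)) (softmaxDeriv (P t) P') t :=
    (hasFDerivAt_softmax (P t)).comp_hasDerivAt t hP
  have ht' : 0 < 1 + t := by linarith
  refine ⟨deriv eta t • (uniformPolicy - softmax (P t)) + (1 - eta t) • softmaxDeriv (P t) P',
    ?_, norm_add_le_of_le ?_ ?_⟩
  · simp only [explore_eq]
    refine ((hη.smul_const uniformPolicy).fun_add ((hη.const_sub 1).fun_smul hf)).congr_deriv ?_
    module
  · rw [norm_smul]
    calc |deriv eta t| * ‖uniformPolicy - softmax (P t)‖ ≤ 1 / (1 + t) * 1 := by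
          gcongr
          · exact (abs_deriv_eta_le ht).trans (by gcongr; exact eta_le_one t)
          · exact isPolicy_uniformPolicy.norm_sub_le_one (isPolicy_softmax _)
      _ = 1 / (1 + t) := mul_one _
  · rw [norm_smul, Real.norm_of_nonneg (sub_nonneg.2 (eta_le_one t))]
    exact (mul_le_of_le_one_left (norm_nonneg _) (sub_le_self _ (eta_pos t).le)).trans
      (norm_softmaxDeriv_apply_le _ _)

open Filter in
theorem isBigO_apply_explore_sub [Nonempty A] {F : (X × A → ℝ) → X × A → ℝ}
    (hF : ∀ f, IsPolicy f → ContDiffAt ℝ 1 F f) (P : ℝ → X × A → ℝ) :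
    (fun t => F (explore t (P t)) - F (softmax (P t))) =O[atTop] eta := by
  obtain ⟨L, hL⟩ :=
    exists_lipschitzOnWith_of_contDiffAt isCompact_setOf_isPolicy convex_setOf_isPolicy hF
  refine .of_bound L (.of_forall fun t => ?_)
  rw [Real.norm_of_nonneg (eta_pos t).le]
  exact (hL.norm_sub_le (isPolicy_explore t (P t)) (isPolicy_softmax (P t))).trans
    (by gcongr; exact norm_explore_sub_softmax_le t (P t))

end Exploration

section Clip

theorem abs_clip_le (lo hi x : ℝ) : |clip lo hi x| ≤ max |lo| |max hi lo| :=
  abs_le_max_abs_abs (le_max_right _ _) (max_le_max_right _ (min_le_right _ _))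

theorem clip_eq_self {lo hi y : ℝ} (hy : y ∈ Set.Icc lo hi) : clip lo hi y = y := by
  rw [clip, min_eq_left hy.2, max_eq_left hy.1]

theorem abs_clip_sub_clip_le (lo hi x y : ℝ) : |clip lo hi x - clip lo hi y| ≤ |x - y| :=
  (abs_max_sub_max_le_abs _ _ _).trans (by simpa using abs_min_sub_min_le_max x hi y hi)

end Clip

section Critic

open Filter Matrix

variable {X A : Type*} [Fintype X] [Fintype A] [DecidableEq X] [DecidableEq A]

section Model

variable (M : MDP X A) {f : X × A → ℝ}

theorem MDP.exists_norm_visiting_le : ∃ C, ∀ f, IsPolicy f → ‖M.visiting f‖ ≤ C :=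
  isCompact_setOf_isPolicy.exists_bound_of_continuousOn fun _ hf =>
    (M.contDiffAt_visiting (n := 0) hf).continuousAt.continuousWithinAt

theorem MDP.exists_norm_actionValue_le : ∃ C, ∀ f, IsPolicy f → ‖M.actionValue f‖ ≤ C :=
  isCompact_setOf_isPolicy.exists_bound_of_continuousOn fun _ hf =>
    (M.contDiffAt_actionValue (n := 0) hf).continuousAt.continuousWithinAt

theorem MDP.exists_hasDerivAt_actionValue :
    ∃ C, 0 ≤ C ∧ ∀ (g : ℝ → X × A → ℝ) (g' : X × A → ℝ) (t : ℝ), IsPolicy (g t) →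
      HasDerivAt g g' t →
      ∃ V', HasDerivAt (fun s => M.actionValue (g s)) V' t ∧ ‖V'‖ ≤ C * ‖g'‖ := by
  have := M.nonempty.map Prod.snd
  obtain ⟨C, hC⟩ := exists_norm_fderiv_le isCompact_setOf_isPolicy
    fun f (hf : IsPolicy f) => M.contDiffAt_actionValue hf
  refine ⟨C, (norm_nonneg _).trans (hC uniformPolicy isPolicy_uniformPolicy),
    fun g g' t hg hgt => ⟨_, HasFDerivAt.comp_hasDerivAt t
      ((M.contDiffAt_actionValue hg).differentiableAt one_ne_zero).hasFDerivAt hgt, ?_⟩⟩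
  exact ContinuousLinearMap.le_of_opNorm_le _ (hC _ hg) _

theorem MDP.bellman_residual_eq (hf : IsPolicy f) (q : X × A → ℝ) :
    M.r + M.γ • M.trans f *ᵥ q - q =
      M.γ • M.trans f *ᵥ (q - M.actionValue f) - (q - M.actionValue f) := by
  have hV := M.actionValue_eq hf
  rw [← trans_mulVec] at hV
  rw [mulVec_sub, smul_sub]
  nth_rw 2 [hV]
  abel

theorem MDP.exists_dotProduct_explore_le (hf : IsPolicy f)
    (hirr : IsIrreducibleChain (M.trans f)) :
    ∃ c, 0 < c ∧ ∃ n : ℕ, ∀ t P π, IsStationary (M.trans (explore t P)) π → ∀ φ : X × A → ℝ,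
      φ ⬝ᵥ (π * (M.γ • M.trans (explore t P) *ᵥ φ - φ)) ≤ -(c * eta t ^ n * ‖φ‖ ^ 2) := by
  have := M.nonempty.map Prod.snd
  have hA : (1 : ℝ) ≤ Fintype.card A := Nat.one_le_cast.2 Fintype.card_pos
  have hγ := M.one_sub_γ_pos
  obtain ⟨c, hc, n, hn⟩ := hirr.exists_stationary_ge fun ξ ξ' =>
    mul_nonneg (M.p_nonneg _ _ _) (hf.nonneg ξ')
  refine ⟨(1 - M.γ) * (c / Fintype.card A ^ n), by positivity, n, fun t P π hπ φ => ?_⟩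
  have hη := eta_pos t
  have hmin (ξ : X × A) : c / Fintype.card A ^ n * eta t ^ n ≤ π ξ := by
    refine (Eq.le ?_).trans (hn (eta t / Fintype.card A) (by positivity)
      (div_le_one_of_le₀ ((eta_le_one t).trans hA) (by positivity)) _ (fun ζ ζ' => ?_) π hπ ξ)
    · ring
    · rw [MDP.trans, MDP.trans, of_apply, of_apply, mul_left_comm]
      exact mul_le_mul_of_nonneg_left (hf.eta_div_card_mul_le_explore t P ζ') (M.p_nonneg _ _ _)
  refine (hπ.dotProduct_discounted_le (M.trans_mem_rowStochastic (isPolicy_explore t P))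
    M.γ_pos.le φ).trans (neg_le_neg ?_)
  calc (1 - M.γ) * (c / Fintype.card A ^ n) * eta t ^ n * ‖φ‖ ^ 2
      = (1 - M.γ) * (c / Fintype.card A ^ n * eta t ^ n * ‖φ‖ ^ 2) := by ring
    _ ≤ (1 - M.γ) * (c / Fintype.card A ^ n * eta t ^ n * ∑ ξ, φ ξ ^ 2) := by
        gcongr
        simpa only [dotProduct, ← sq] using norm_sq_le_dotProduct_self φ
    _ ≤ (1 - M.γ) * ∑ ξ, π ξ * φ ξ ^ 2 := by
        rw [Finset.mul_sum]
        gcongr with ξ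
        exact hmin ξ

/-- The signal that drives the logits: the kernel is applied to it in the actor equation. It is the
policy gradient with the critic `Q`, clipped, in place of the value function. -/
def MDP.actorSignal (lo hi t : ℝ) (P Q : X × A → ℝ) : X × A → ℝ :=
  center (softmax P) (M.visiting (explore t P) * fun ξ => clip lo hi (Q ξ))

theorem MDP.exists_norm_actorSignal_le (lo hi : ℝ) :
    ∃ C, ∀ t P Q, ‖M.actorSignal lo hi t P Q‖ ≤ C := by
  have := M.nonempty.map Prod.snd
  obtain ⟨C, hC⟩ := M.exists_norm_visiting_le
  refine ⟨(1 + Fintype.card A) * (C * max |lo| |max hi lo|), fun t P Q => ?_⟩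
  have hvis := hC _ (isPolicy_explore t P)
  have hclip : ‖fun ξ => clip lo hi (Q ξ)‖ ≤ max |lo| |max hi lo| :=
    (pi_norm_le_iff_of_nonneg (by positivity)).2 fun ξ => abs_clip_le lo hi (Q ξ)
  refine ((isPolicy_softmax P).norm_center_le _).trans ?_
  gcongr
  exact (norm_mul_le _ _).trans (by gcongr; exact (norm_nonneg _).trans hvis)

open scoped Matrix.Norms.Operator in
theorem MDP.exists_norm_mulVec_actorSignal_le (B : Matrix (X × A) (X × A) ℝ) (lo hi : ℝ) :
    ∃ C, ∀ t P Q, ‖B *ᵥ M.actorSignal lo hi t P Q‖ ≤ C := by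
  obtain ⟨C, hC⟩ := M.exists_norm_actorSignal_le lo hi
  exact ⟨‖B‖ * C, fun t P Q => (linfty_opNorm_mulVec _ _).trans (by gcongr; exact hC t P Q)⟩

end Model

namespace IsLimitODESolution

variable {M : MDP X A} {K : X × A → X × A → ℝ} {α κ lo hi : ℝ} {P Q : ℝ → X × A → ℝ}

theorem hasDerivAt_actor (h : IsLimitODESolution M K α κ lo hi P Q) {t : ℝ} (ht : 0 < t) :
    HasDerivAt P ((1 + t)⁻¹ • (κ • of K) *ᵥ M.actorSignal lo hi t (P t) (Q t)) t := by
  refine ((h.actor t ht.le).hasDerivAt (Ici_mem_nhds ht)).congr_deriv ?_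
  funext ξ
  simp only [smul_mulVec, Pi.smul_apply, smul_eq_mul, mulVec, MDP.actorSignal]
  rw [← sum_mul_sub_sum_eq_dotProduct_center, Finset.mul_sum, Finset.mul_sum]
  refine Finset.sum_congr rfl fun ξ' _ => ?_
  simp only [zeta, one_div, Pi.mul_apply, of_apply]
  ring

theorem exists_hasDerivAt_critic (h : IsLimitODESolution M K α κ lo hi P Q) {t : ℝ} (ht : 0 < t) :
    ∃ π, IsStationary (M.trans (explore t (P t))) π ∧
      HasDerivAt Q (α • of K *ᵥ (π * (M.γ • M.trans (explore t (P t)) *ᵥ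
          (Q t - M.actionValue (explore t (P t))) -
        (Q t - M.actionValue (explore t (P t)))))) t := by
  have := M.nonempty.map Prod.snd
  obtain ⟨π, hπ, hQ⟩ := h.critic t ht.le
  refine ⟨π, hπ, (hQ.hasDerivAt (Ici_mem_nhds ht)).congr_deriv ?_⟩
  have hstep (ξ : X × A) : ∑ z, ∑ a, Q t (z, a) * explore t (P t) (z, a) * M.p ξ.1 ξ.2 z =
      (M.trans (explore t (P t)) *ᵥ Q t) ξ := by
    simp only [mulVec, dotProduct, MDP.trans, of_apply, Fintype.sum_prod_type]
    exact Finset.sum_congr rfl fun z _ => Finset.sum_congr rfl fun a _ => by ring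
  rw [← M.bellman_residual_eq (isPolicy_explore t (P t))]
  funext ξ
  simp only [hstep, Pi.smul_apply, smul_eq_mul, mulVec, dotProduct, of_apply]
  refine congrArg (α * ·) (Finset.sum_congr rfl fun ξ' _ => ?_)
  simp only [Pi.mul_apply, Pi.sub_apply, Pi.add_apply, Pi.smul_apply, smul_eq_mul, mulVec,
    dotProduct]
  ring

theorem exists_hasDerivAt_actionValue_explore (h : IsLimitODESolution M K α κ lo hi P Q) :
    ∃ D, ∀ t, 0 < t → ∃ V', HasDerivAt (fun s => M.actionValue (explore s (P s))) V' t ∧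
      ‖V'‖ ≤ D / (1 + t) := by
  have := M.nonempty.map Prod.snd
  obtain ⟨C, hC, hV⟩ := M.exists_hasDerivAt_actionValue
  obtain ⟨B, hB⟩ := M.exists_norm_mulVec_actorSignal_le (κ • of K) lo hi
  refine ⟨C * (1 + 2 * B), fun t ht => ?_⟩
  obtain ⟨g', hg', hg'_le⟩ := exists_hasDerivAt_explore (by linarith) (h.hasDerivAt_actor ht)
  obtain ⟨V', hV', hV'_le⟩ := hV _ g' t (isPolicy_explore t (P t)) hg'
  rw [norm_smul, Real.norm_of_nonneg (by positivity)] at hg'_le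
  refine ⟨V', hV', hV'_le.trans ?_⟩
  calc C * ‖g'‖ ≤ C * (1 / (1 + t) + 2 * ((1 + t)⁻¹ * B)) := by
        gcongr
        exact hg'_le.trans (by gcongr; exact hB _ _ _)
    _ = C * (1 + 2 * B) / (1 + t) := by ring

theorem isBigO_critic_sub_explore (h : IsLimitODESolution M K α κ lo hi P Q)
    (hK : (of K).PosDef) (hα : 0 < α) {f : X × A → ℝ} (hf : IsPolicy f)
    (hirr : IsIrreducibleChain (M.trans f)) :
    (fun t => Q t - M.actionValue (explore t (P t))) =O[atTop] eta := by
  obtain ⟨c, hc, n, hdamp⟩ := M.exists_dotProduct_explore_le hf hirr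
  obtain ⟨D, hD⟩ := h.exists_hasDerivAt_actionValue_explore
  choose! V' hV' hV'_le using hD
  choose! π hπ hQ using fun t (ht : 0 < t) => h.exists_hasDerivAt_critic ht
  refine isBigO_eta_of_damped hK (v := -V') (mul_pos hα hc) n
    (w := fun t => α • (π t * (M.γ • M.trans (explore t (P t)) *ᵥ
      (Q t - M.actionValue (explore t (P t))) - (Q t - M.actionValue (explore t (P t))))))
    ((eventually_gt_atTop 0).mono fun t ht => ?_) ((eventually_gt_atTop 0).mono fun t ht => ?_)
    ((eventually_gt_atTop 0).mono fun t ht => by simpa using hV'_le t ht)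
  · rw [mulVec_smul]
    exact (hQ t ht).sub (hV' t ht)
  · rw [dotProduct_smul, smul_eq_mul]
    linarith [mul_le_mul_of_nonneg_left (hdamp t (P t) _ (hπ t ht)
      (Q t - M.actionValue (explore t (P t)))) hα.le]

theorem isBigO_critic_sub (h : IsLimitODESolution M K α κ lo hi P Q)
    (hK : (of K).PosDef) (hα : 0 < α) {f : X × A → ℝ} (hf : IsPolicy f)
    (hirr : IsIrreducibleChain (M.trans f)) :
    (fun t => Q t - M.actionValue (softmax (P t))) =O[atTop] eta := by
  have := M.nonempty.map Prod.snd
  simpa using (h.isBigO_critic_sub_explore hK hα hf hirr).add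
    (isBigO_apply_explore_sub (fun _ hf => M.contDiffAt_actionValue hf) P)

end IsLimitODESolution

end Critic

section Ascent

open Filter Matrix
open scoped NNReal

theorem exists_tendsto_of_deriv_nonneg {Φ Φ' : ℝ → ℝ} {m u₀ : ℝ}
    (hΦ : ∀ u, u₀ ≤ u → HasDerivAt Φ (Φ' u) u) (hΦ' : ∀ u, u₀ ≤ u → 0 ≤ Φ' u)
    (hm : ∀ u, u₀ ≤ u → Φ u ≤ m) : ∃ l, Tendsto Φ atTop (𝓝 l) := by
  have hmono : MonotoneOn Φ (Set.Ici u₀) :=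
    monotoneOn_of_hasDerivWithinAt_nonneg (convex_Ici u₀)
      (fun u hu => (hΦ u hu).continuousAt.continuousWithinAt)
      (fun u hu => (hΦ u (interior_subset hu)).hasDerivWithinAt)
      fun u hu => hΦ' u (interior_subset hu)
  have hmax : Monotone fun u => Φ (max u₀ u) := fun u v huv =>
    hmono (le_max_left u₀ u) (le_max_left u₀ v) (max_le_max_left u₀ huv)
  refine ⟨_, (tendsto_atTop_ciSup hmax ⟨m, ?_⟩).congr' ?_⟩
  · rintro _ ⟨u, rfl⟩
    exact hm _ (le_max_left u₀ u)
  · exact (eventually_ge_atTop u₀).mono fun u hu => by simp only [max_eq_right hu]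

theorem tendsto_zero_of_lipschitzOnWith_of_sq_le_deriv {E : Type*} [NormedAddCommGroup E]
    {F : ℝ → E} {Φ Φ' : ℝ → ℝ} {c m u₀ : ℝ} {L : ℝ≥0} (hc : 0 < c)
    (hF : LipschitzOnWith L F (Set.Ici u₀)) (hΦ : ∀ u, u₀ ≤ u → HasDerivAt Φ (Φ' u) u)
    (hΦ' : ∀ u, u₀ ≤ u → c * ‖F u‖ ^ 2 ≤ Φ' u) (hm : ∀ u, u₀ ≤ u → Φ u ≤ m) :
    Tendsto F atTop (𝓝 0) := by
  obtain ⟨l, hl⟩ := exists_tendsto_of_deriv_nonneg hΦ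
    (fun u hu => (by positivity : 0 ≤ c * ‖F u‖ ^ 2).trans (hΦ' u hu)) hm
  refine Metric.tendsto_nhds.2 fun ε hε => ?_
  obtain ⟨δ, hδ, hLδ⟩ : ∃ δ, 0 < δ ∧ L * δ ≤ ε / 2 := by
    refine ⟨ε / 2 / (L + 1), by positivity, ?_⟩
    rw [mul_div_left_comm]
    exact mul_le_of_le_one_right (by positivity) (div_le_one_of_le₀ (by simp) (by positivity))
  have hincr : Tendsto (fun u => Φ (u + δ) - Φ u) atTop (𝓝 0) := by
    simpa using (hl.comp (tendsto_atTop_add_const_right _ δ tendsto_id)).sub hl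
  filter_upwards [hincr.eventually_lt_const (by positivity : 0 < c * (ε / 2) ^ 2 * δ),
    eventually_ge_atTop u₀] with u hsmall hu
  obtain ⟨v, ⟨huv, hvu⟩, hv⟩ := exists_hasDerivAt_eq_slope Φ Φ' (lt_add_of_pos_right u hδ)
    (fun s hs => (hΦ s (hu.trans hs.1)).continuousAt.continuousWithinAt)
    (fun s hs => hΦ s (hu.trans hs.1.le))
  have hFv : ‖F v‖ < ε / 2 := by
    rw [add_sub_cancel_left] at hv
    have hlt : c * ‖F v‖ ^ 2 < c * (ε / 2) ^ 2 :=
      (hΦ' v (hu.trans huv.le)).trans_lt (hv ▸ (div_lt_iff₀ hδ).2 hsmall)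
    exact lt_of_pow_lt_pow_left₀ 2 (by positivity) (lt_of_mul_lt_mul_left hlt hc.le)
  have hFuv : ‖F v - F u‖ ≤ ε / 2 := by
    refine (hF.norm_sub_le (hu.trans huv.le) hu).trans (le_trans ?_ hLδ)
    gcongr
    rw [Real.norm_of_nonneg (by linarith)]
    linarith
  rw [dist_zero_right]
  linarith [norm_le_norm_add_norm_sub (F v) (F u)]

variable {S : Type*} [Fintype S] {B : Matrix S S ℝ}

theorem exists_norm_sq_sub_le_mulVec_dotProduct (hB : B.PosDef) :
    ∃ a, 0 < a ∧ ∃ b, 0 < b ∧ ∀ g w : S → ℝ,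
      a * ‖g‖ ^ 2 - b * (‖g‖ * ‖w - g‖) ≤ B *ᵥ w ⬝ᵥ g := by
  obtain ⟨a, ha, hlower⟩ := exists_pos_mul_norm_sq_le_of_posDef hB
  obtain ⟨b, hb, hupper⟩ := exists_abs_dotProduct_mulVec_le B
  refine ⟨a, ha, b, hb, fun g w => ?_⟩
  have hsplit : B *ᵥ w ⬝ᵥ g = g ⬝ᵥ B *ᵥ g + g ⬝ᵥ B *ᵥ (w - g) := by
    rw [dotProduct_comm, mulVec_sub, dotProduct_sub, add_sub_cancel]
  linarith [hlower g, neg_le_of_abs_le (hupper g (w - g))]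

open scoped Matrix.Norms.Operator in
theorem tendsto_gradient_of_perturbed_ascent (hB : B.PosDef) {J : (S → ℝ) → ℝ}
    {G : (S → ℝ) → S → ℝ} {p W : ℝ → S → ℝ} {m C D : ℝ} {L : ℝ≥0} (hJ : Differentiable ℝ J)
    (hJG : ∀ x k, fderiv ℝ J x k = k ⬝ᵥ G x) (hm : ∀ x, J x ≤ m) (hC : ∀ x, ‖G x‖ ≤ C)
    (hL : LipschitzWith L G) (hp : ∀ᶠ u in atTop, HasDerivAt p (B *ᵥ W u) u)
    (hW : ∀ᶠ u in atTop, ‖W u - G (p u)‖ ≤ D * (1 / (1 + u ^ 2))) :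
    Tendsto (fun u => G (p u)) atTop (𝓝 0) := by
  obtain ⟨u₀, h₀⟩ := (hp.and hW).exists_forall_of_atTop
  choose hp hW using h₀
  obtain ⟨a, ha, b, hb, hascent⟩ := exists_norm_sq_sub_le_mulVec_dotProduct hB
  have hC0 : 0 ≤ C := (norm_nonneg _).trans (hC 0)
  have hD0 : 0 ≤ D := nonneg_of_mul_nonneg_left ((norm_nonneg _).trans (hW u₀ le_rfl))
    (by positivity)
  have hspeed (u : ℝ) (hu : u₀ ≤ u) : ‖B *ᵥ W u‖ ≤ ‖B‖ * (D + C) := by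
    refine (linfty_opNorm_mulVec _ _).trans ?_
    gcongr
    calc ‖W u‖ ≤ ‖W u - G (p u)‖ + ‖G (p u)‖ := by simpa using norm_add_le (W u - G (p u)) (G (p u))
      _ ≤ D * (1 / (1 + u ^ 2)) + C := add_le_add (hW u hu) (hC _)
      _ ≤ D + C := by
        gcongr
        exact mul_le_of_le_one_right hD0 (div_le_one_of_le₀ (by nlinarith) (by positivity))
  have hlip : LipschitzOnWith (L * (‖B‖ * (D + C)).toNNReal) (fun u => G (p u)) (Set.Ici u₀) :=
    hL.comp_lipschitzOnWith <| (convex_Ici u₀).lipschitzOnWith_of_nnnorm_hasDerivWithin_le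
      (fun u hu => (hp u hu).hasDerivWithinAt)
      fun u hu => NNReal.le_toNNReal_of_coe_le (hspeed u hu)
  -- The derivative `1 / (1 + u²)` of `arctan` absorbs the perturbation.
  refine tendsto_zero_of_lipschitzOnWith_of_sq_le_deriv ha hlip
    (Φ := fun u => J (p u) + b * (C * D) * Real.arctan u) (m := m + b * (C * D) * (Real.pi / 2))
    (fun u hu => (((hJ (p u)).hasFDerivAt.comp_hasDerivAt u (hp u hu)).add
      ((Real.hasDerivAt_arctan u).const_mul _))) (fun u hu => ?_) fun u _ => ?_
  · have herr : ‖G (p u)‖ * ‖W u - G (p u)‖ ≤ C * (D * (1 / (1 + u ^ 2))) := by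
      gcongr
      exacts [hC _, hW u hu]
    rw [hJG]
    linarith [hascent (G (p u)) (W u), mul_le_mul_of_nonneg_left herr hb.le]
  · gcongr
    exacts [hm _, (Real.arctan_lt_pi_div_two u).le]

end Ascent

section Actor

open Filter Matrix
open scoped NNReal

variable {X A : Type*} [Fintype X] [Fintype A] [DecidableEq X] [DecidableEq A]

theorem eta_exp_sub_one (u : ℝ) : eta (Real.exp u - 1) = 1 / (1 + u ^ 2) := by
  rw [eta, sub_add_cancel, Real.log_exp]

theorem MDP.exists_lipschitzWith_softmaxGradient_softmax (M : MDP X A) :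
    ∃ L, LipschitzWith L fun P => M.softmaxGradient (softmax P) := by
  have := M.nonempty.map Prod.snd
  obtain ⟨L, hL⟩ := M.exists_lipschitzOnWith_softmaxGradient
  exact ⟨L * 2, lipschitzOnWith_univ.1 <| hL.comp lipschitzWith_softmax.lipschitzOnWith
    fun P _ => isPolicy_softmax P⟩

theorem MDP.isBigO_actorSignal_sub (M : MDP X A) {lo hi : ℝ} {P Q : ℝ → X × A → ℝ}
    (hQ : (fun t => Q t - M.actionValue (softmax (P t))) =O[atTop] eta)
    (hwin : ∀ f, IsPolicy f → ∀ ξ, M.actionValue f ξ ∈ Set.Icc lo hi) :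
    (fun t => M.actorSignal lo hi t (P t) (Q t) - M.softmaxGradient (softmax (P t)))
      =O[atTop] eta := by
  have := M.nonempty.map Prod.snd
  obtain ⟨B, hB⟩ := M.exists_norm_visiting_le
  obtain ⟨C, hC⟩ := M.exists_norm_actionValue_le
  have hσ : (fun t => M.visiting (explore t (P t))) =O[atTop] fun _ => (1 : ℝ) :=
    .of_bound B (.of_forall fun t => by simpa using hB _ (isPolicy_explore t (P t)))
  have hV : (fun t => M.actionValue (softmax (P t))) =O[atTop] fun _ => (1 : ℝ) :=
    .of_bound C (.of_forall fun t => by simpa using hC _ (isPolicy_softmax (P t)))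
  have hclip : (fun t => (fun ξ => clip lo hi (Q t ξ)) - M.actionValue (softmax (P t)))
      =O[atTop] eta := by
    refine .trans (.of_bound 1 (.of_forall fun t => ?_)) hQ
    rw [one_mul]
    refine (pi_norm_le_iff_of_nonneg (norm_nonneg _)).2 fun ξ => ?_
    refine le_trans ?_ (norm_le_pi_norm _ ξ)
    have hlip := abs_clip_sub_clip_le lo hi (Q t ξ) (M.actionValue (softmax (P t)) ξ)
    rwa [clip_eq_self (hwin _ (isPolicy_softmax (P t)) ξ)] at hlip
  have hvis := isBigO_apply_explore_sub (fun _ hf => M.contDiffAt_visiting hf) P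
  have hprod : (fun t => M.visiting (explore t (P t)) * (fun ξ => clip lo hi (Q t ξ)) -
      M.visiting (softmax (P t)) * M.actionValue (softmax (P t))) =O[atTop] eta := by
    have hsum := (hσ.mul hclip).add ((hvis.mul hV).congr_right fun t => mul_comm _ _)
    refine hsum.congr (fun t => ?_) fun t => one_mul _
    ring
  refine .trans (.of_bound (1 + Fintype.card A) (.of_forall fun t => ?_)) hprod
  rw [MDP.actorSignal, MDP.softmaxGradient, ← center_sub]
  exact (isPolicy_softmax (P t)).norm_center_le _

namespace IsLimitODESolution

variable {M : MDP X A} {K : X × A → X × A → ℝ} {α κ lo hi : ℝ} {P Q : ℝ → X × A → ℝ}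

theorem tendsto_softmaxGradient (h : IsLimitODESolution M K α κ lo hi P Q)
    (hK : (of K).PosDef) (hκ : 0 < κ)
    (hQ : (fun t => Q t - M.actionValue (softmax (P t))) =O[atTop] eta)
    (hwin : ∀ f, IsPolicy f → ∀ ξ, M.actionValue f ξ ∈ Set.Icc lo hi) :
    Tendsto (fun t => M.softmaxGradient (softmax (P t))) atTop (𝓝 0) := by
  have := M.nonempty.map Prod.snd
  obtain ⟨m, hm⟩ := M.exists_objective_le
  obtain ⟨C, hC⟩ := M.exists_norm_softmaxGradient_le
  obtain ⟨L, hL⟩ := M.exists_lipschitzWith_softmaxGradient_softmax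
  have hτ : Tendsto (fun u => Real.exp u - 1) atTop atTop :=
    tendsto_atTop_add_const_right _ _ Real.tendsto_exp_atTop
  obtain ⟨D, hD⟩ := ((M.isBigO_actorSignal_sub hQ hwin).comp_tendsto hτ).bound
  have hpu : Tendsto (fun u => M.softmaxGradient (softmax (P (Real.exp u - 1)))) atTop (𝓝 0) := by
    refine tendsto_gradient_of_perturbed_ascent (hK.smul hκ) (D := D)
      (G := fun P => M.softmaxGradient (softmax P))
      (W := fun u => M.actorSignal lo hi (Real.exp u - 1) (P (Real.exp u - 1)) (Q (Real.exp u - 1)))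
      (fun P => (M.hasFDerivAt_objective_softmax P).differentiableAt)
      M.fderiv_objective_softmax_apply (fun P => hm _ (isPolicy_softmax P))
      (fun P => hC _ (isPolicy_softmax P)) hL
      ((hτ.eventually_gt_atTop 0).mono fun u hu => ?_) (hD.mono fun u hu => ?_)
    · refine ((h.hasDerivAt_actor hu).scomp u ((Real.hasDerivAt_exp u).sub_const 1)).congr_deriv ?_
      rw [add_sub_cancel, smul_inv_smul₀ (Real.exp_ne_zero u)]
    · simpa [eta_exp_sub_one, abs_of_pos (by positivity : 0 < 1 + u ^ 2)] using hu
  have hlog : Tendsto (fun t : ℝ => Real.log (1 + t)) atTop atTop :=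
    Real.tendsto_log_atTop.comp (tendsto_atTop_add_const_left _ 1 tendsto_id)
  refine (hpu.comp hlog).congr' ((eventually_gt_atTop 0).mono fun t ht => ?_)
  rw [Function.comp_apply, Real.exp_log (by linarith), add_sub_cancel_left]

end IsLimitODESolution

end Actor

section Convergence

theorem MDP.IsErgodic.exists_isIrreducibleChain {X A : Type*} [Fintype X] [Fintype A]
    [DecidableEq X] [DecidableEq A] {M : MDP X A} (hM : M.IsErgodic) :
    ∃ f, IsPolicy f ∧ IsIrreducibleChain (M.trans f) := by
  have := M.nonempty.map Prod.snd
  exact ⟨uniformPolicy, isPolicy_uniformPolicy, (hM uniformPolicy isPolicy_uniformPolicy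
    fun _ => inv_pos.2 (Nat.cast_pos.2 Fintype.card_pos)).1.1⟩

end Convergence

end ActorCritic

end

open ActorCritic Filter in
theorem theorem2_general {X A : Type*} [Fintype X] [Fintype A] [DecidableEq X] [DecidableEq A]
    (M : MDP X A) (hM : ∃ f, IsPolicy f ∧ IsIrreducibleChain (M.trans f))
    {K : X × A → X × A → ℝ} (hK : (Matrix.of K).PosDef) {α κ : ℝ} (hα : 0 < α) (hκ : 0 < κ)
    {lo hi : ℝ} {P Q : ℝ → X × A → ℝ} (hODE : IsLimitODESolution M K α κ lo hi P Q) :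
    (fun t => ‖Q t - M.actionValue (softmax (P t))‖) =O[atTop] eta ∧
    Differentiable ℝ (fun P' : X × A → ℝ => M.objective (softmax P')) ∧
    ((∀ f : X × A → ℝ, IsPolicy f → ∀ ξ, M.actionValue f ξ ∈ Set.Icc lo hi) →
      Tendsto (fun t => M.policyGradient (P t)) atTop (𝓝 0)) := by
  obtain ⟨f, hf, hirr⟩ := hM
  have hcritic := hODE.isBigO_critic_sub hK hα hf hirr
  refine ⟨hcritic.norm_left,
    fun P' => (M.hasFDerivAt_objective_softmax P').differentiableAt, fun hwin => ?_⟩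
  simpa only [M.policyGradient_eq] using hODE.tendsto_softmaxGradient hK hκ hcritic hwin

theorem theorem2 {X A : Type*} [Fintype X] [Fintype A] [DecidableEq X] [DecidableEq A]
    {dx da : ℕ}
    -- the finite MDP and its ergodicity
    (M : ActorCritic.MDP X A) (hM : M.IsErgodic)
    -- states and actions are distinct points of Euclidean spaces; one state coordinate is the bias
    (eX : X → EuclideanSpace ℝ (Fin dx)) (eA : A → EuclideanSpace ℝ (Fin da))
    (heX : Function.Injective eX) (heA : Function.Injective eA)
    (hbias : ∃ i : Fin dx, ∀ x, eX x i = 1)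
    -- activation function
    (act : ℝ → ℝ) (hact : ActorCritic.IsActivation act) (hconst : ∃ x y, act x ≠ act y)
    -- law of the initial network parameters `(c, w)`
    (ν₀ : MeasureTheory.Measure (ℝ × ActorCritic.Feat dx da)) [MeasureTheory.IsProbabilityMeasure ν₀]
    (hac : MeasureTheory.Measure.AbsolutelyContinuous ν₀ MeasureTheory.volume)
    (hc : ∀ᵐ z ∂ν₀, |z.1| ≤ 1)
    (hw : AnalyticOnNhd ℝ act Set.univ ∨
      ∀ U : Set (ActorCritic.Feat dx da), IsOpen U → U.Nonempty → 0 < ν₀ (Prod.snd ⁻¹' U))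
    -- a solution of the limit ODE, from an arbitrary starting point
    (α : ℝ) (hα : 0 < α) (κ : ℝ) (hκ : κ = 1 ∨ κ = 1 - M.γ) (lo hi : ℝ)
    (P Q : ℝ → X × A → ℝ)
    (hODE : ActorCritic.IsLimitODESolution M (ActorCritic.kernel eX eA act ν₀) α κ lo hi P Q) :
    -- the critic tracks the value function of the current policy
    (fun t => ‖Q t - M.actionValue (ActorCritic.softmax (P t))‖) =O[Filter.atTop] ActorCritic.eta ∧
    -- the objective is differentiable in the logits, so that its gradient is a genuine one
    Differentiable ℝ (fun P' : X × A → ℝ => M.objective (ActorCritic.softmax P')) ∧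
    -- the actor converges to a stationary point if the clipping window contains the values
    ((∀ f : X × A → ℝ, ActorCritic.IsPolicy f → ∀ ξ, M.actionValue f ξ ∈ Set.Icc lo hi) →
      Filter.Tendsto (fun t => M.policyGradient (P t)) Filter.atTop (nhds 0)) := by
  have hκ_pos : 0 < κ := by
    rcases hκ with rfl | rfl
    exacts [one_pos, M.one_sub_γ_pos]
  exact theorem2_general M hM.exists_isIrreducibleChain
    (ActorCritic.kernel_posDef heX heA hbias hact hconst hac hc hw) hα hκ_pos hODE
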